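/- **Theorem.** Let $t,m,k$ be non-negative integers, and consider the following five sets. (a) The self-conjugate $t$-cores (partitions with no hook length equal to $t$) with exactly $m$ corners (boxes whose removal leaves a Young diagram) and with first hook length $h(1,1)<kt$; for the empty partition, which has no box $(1,1)$, the last condition is regarded as satisfied. (b) The integer sequences $(n_0,n_1,\dots,n_{\lfloor t/2\rfloor-1})$ such that $n_0>0$ if $m$ is odd and $n_0\le 0$ if $m$ is even, $-\lfloor k/2\rfloor\le n_i\le\lfloor (k+1)/2\rfloor$ for all $0\le i\le\lfloor t/2\rfloor-1$, and $$\sum_{i=0}^{\lfloor t/2\rfloor}|n_i-n_{i-1}|=\begin{cases}m+1&\text{if } m \text{ is odd},\\ m&\text{if } m\text{ is even},\end{cases}$$ where $n_{-1}:=0$ and $n_{\lfloor t/2\rfloor}:=0$. (c) The set $\mathcal F_{\rm c}(m,\lfloor t/2\rfloor,k)$. (d) The set $\mathcal M_{\rm c}(m,\lfloor t/2\rfloor,k)$. (e) The cornerless symmetric Motzkin paths of length $2m+t-1$ with exactly $t-1$ flat steps that are contained in the strip $0\le y\le k$. Then there are bijections between any two of the sets (a), (b), (c). If $t\ge 1$,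 there are also bijections between (e) and each of these. If $t\ge 2$, there is a bijection between any two of the five sets. Here all paths consist of up steps $(1,1)$, down steps $(1,-1)$ and flat steps $(1,0)$. A *Motzkin prefix* starts at $(0,0)$ and stays weakly above the $x$-axis, and a *Motzkin path* is a Motzkin prefix that ends on the $x$-axis. A *free Motzkin path* starts at $(0,0)$ or $(0,1)$ and ends on the $x$-axis. A path is *cornerless* if no up step is immediately followed by a down step and no down step by an up step, and *symmetric* if it equals its mirror image in a vertical line. Put $L_i=\lfloor (i+1)/2\rfloor$ for odd $i$ and $L_i=-\lfloor i/2\rfloor$ for even $i$. Then $\mathcal F_{\rm c}(m,r,k)$ is the union over $0\le i\le k$ of the sets of cornerless free Motzkin paths of length $m+r$ with exactly $r$ flat steps that are contained in the strip $-\lfloor i/2\rfloor\le y\le\lfloor (i+1)/2\rfloor$, touch the line $y=L_i$, and do not start with a down step if $m$ is odd, and do not start with an up step if $m$ is even. Likewise $\mathcal M_{\rm c}(m,r,k)$ is the union over $0\le i\le k$ of the sets of cornerless Motzkin prefixes of length $m+r$ with exactly $r$ flat steps that are contained in the strip $0\le y\le i$, touch the line $y=i$, and end with a flat step. -/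

import Mathlib

namespace CoreMotzkin

/-! ### Partitions, as Young diagrams

A partition is identified with its Young diagram. Boxes are pairs `(row, column)`, counted from
`0`, so the box written `(1,1)` in the usual convention is `(0, 0)`. -/

/-- The hook length of the box `(i, j)`: the number of boxes weakly to its right in row `i` or
weakly below it in column `j`. -/
def hookLength (μ : YoungDiagram) (i j : ℕ) : ℕ :=
  (μ.cells.filter fun c => (c.1 = i ∧ j ≤ c.2) ∨ (c.2 = j ∧ i ≤ c.1)).card

/-- A `t`-core: no box has hook length `t`. -/
def IsCore (t : ℕ) (μ : YoungDiagram) : Prop :=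
  ∀ i j : ℕ, (i, j) ∈ μ → hookLength μ i j ≠ t

/-- A self-conjugate partition. -/
def IsSelfConjugate (μ : YoungDiagram) : Prop :=
  μ.transpose = μ

/-- The inner corners: the boxes whose removal leaves a Young diagram. -/
def innerCorners (μ : YoungDiagram) : Set (ℕ × ℕ) :=
  {c | c ∈ μ ∧ IsLowerSet ((μ.cells.erase c : Finset (ℕ × ℕ)) : Set (ℕ × ℕ))}

/-- Self-conjugate `t`-cores with `m` inner corners whose first hook length `h(1,1)` is less than
`k * t`. The empty partition has no box `(1,1)`, so it always satisfies the last condition. -/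
def selfConjugateCores (t m k : ℕ) : Set YoungDiagram :=
  {μ | IsSelfConjugate μ ∧ IsCore t μ ∧ (innerCorners μ).ncard = m ∧
    ((0, 0) ∈ μ → hookLength μ 0 0 < k * t)}

/-! ### Integer sequences -/

/-- The sequence `n_0, …, n_{r-1}`, extended by `0` to all other integer indices; in particular
`n_{-1} = n_r = 0`. -/
def extend {r : ℕ} (n : Fin r → ℤ) (i : ℤ) : ℤ :=
  if h : 0 ≤ i ∧ i < r then n ⟨i.toNat, by omega⟩ else 0

/-- Integer sequences `(n_0, …, n_{⌊t/2⌋-1})` in the range `-⌊k/2⌋ ≤ n_i ≤ ⌊(k+1)/2⌋` with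
`n_0 > 0` for odd `m`, `n_0 ≤ 0` for even `m`, and `∑_{i=0}^{⌊t/2⌋} |n_i - n_{i-1}|` equal to
`m + 1` for odd `m` and to `m` for even `m`. -/
def boundedSequences (t m k : ℕ) : Set (Fin (t / 2) → ℤ) :=
  {n | (Odd m → 0 < extend n 0) ∧ (Even m → extend n 0 ≤ 0) ∧
    (∀ i, -((k / 2 : ℕ) : ℤ) ≤ n i ∧ n i ≤ (((k + 1) / 2 : ℕ) : ℤ)) ∧
    ∑ i ∈ Finset.range (t / 2 + 1), |extend n (i : ℤ) - extend n ((i : ℤ) - 1)| =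
      if Odd m then (m : ℤ) + 1 else (m : ℤ)}

/-! ### Lattice paths -/

/-- Up steps `(1,1)`, down steps `(1,-1)` and flat steps `(1,0)`. -/
inductive Step where
  | up
  | down
  | flat
  deriving DecidableEq

/-- The change of height along a step. -/
def Step.rise : Step → ℤ
  | .up => 1
  | .down => -1
  | .flat => 0

/-- The mirror image of a step in a vertical line. -/
def Step.flip : Step → Step
  | .up => .down
  | .down => .up
  | .flat => .flat

/-- A lattice path that starts at the point `(0, start)` and then takes the given steps. -/
@[ext]
structure LatticePath where
  start : ℤ
  steps : List Step

namespace LatticePath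

/-- The number of steps. -/
def length (P : LatticePath) : ℕ := P.steps.length

/-- The number of flat steps. -/
def flats (P : LatticePath) : ℕ := P.steps.count Step.flat

/-- The height of the path after `i` steps. -/
def height (P : LatticePath) (i : ℕ) : ℤ :=
  P.start + ((P.steps.take i).map Step.rise).sum

/-- The path is contained in the strip `a ≤ y ≤ b`. -/
def InStrip (P : LatticePath) (a b : ℤ) : Prop :=
  ∀ i ≤ P.length, a ≤ P.height i ∧ P.height i ≤ b

/-- The path touches the line `y = a`. -/
def Touches (P : LatticePath) (a : ℤ) : Prop :=
  ∃ i ≤ P.length, P.height i = a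

/-- A cornerless path: no peak (an up step followed by a down step) and no valley (a down step
followed by an up step). -/
def Cornerless (P : LatticePath) : Prop :=
  ∀ i : ℕ, ¬ (P.steps[i]? = some Step.up ∧ P.steps[i + 1]? = some Step.down) ∧
    ¬ (P.steps[i]? = some Step.down ∧ P.steps[i + 1]? = some Step.up)

/-- A free Motzkin path: it starts at `(0,0)` or `(0,1)` and ends on the `x`-axis. -/
def IsFreeMotzkin (P : LatticePath) : Prop :=
  (P.start = 0 ∨ P.start = 1) ∧ P.height P.length = 0

/-- A Motzkin prefix: it starts at `(0,0)` and stays weakly above the `x`-axis. -/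
def IsMotzkinPrefix (P : LatticePath) : Prop :=
  P.start = 0 ∧ ∀ i ≤ P.length, 0 ≤ P.height i

/-- A Motzkin path: a Motzkin prefix that ends on the `x`-axis. -/
def IsMotzkin (P : LatticePath) : Prop :=
  P.IsMotzkinPrefix ∧ P.height P.length = 0

/-- The step sequence equals that of the mirror image of the path in a vertical line. -/
def IsSymmetric (P : LatticePath) : Prop :=
  (P.steps.map Step.flip).reverse = P.steps

end LatticePath

/-- The free Motzkin paths of length `m + r` with `r` flat steps in the strip
`-⌊k/2⌋ ≤ y ≤ ⌊(k+1)/2⌋`. -/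
def freePaths (m r k : ℕ) : Set LatticePath :=
  {P | P.IsFreeMotzkin ∧ P.length = m + r ∧ P.flats = r ∧
    P.InStrip (-((k / 2 : ℕ) : ℤ)) (((k + 1) / 2 : ℕ) : ℤ)}

/-- The Motzkin prefixes of length `m + r` with `r` flat steps in the strip `0 ≤ y ≤ k`. -/
def motzkinPrefixes (m r k : ℕ) : Set LatticePath :=
  {P | P.IsMotzkinPrefix ∧ P.length = m + r ∧ P.flats = r ∧ P.InStrip 0 k}

/-- The height of the boundary line `L_k`: `⌊(k+1)/2⌋` for odd `k`, `-⌊k/2⌋` for even `k`. -/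
def boundaryLine (k : ℕ) : ℤ :=
  if Odd k then (((k + 1) / 2 : ℕ) : ℤ) else -((k / 2 : ℕ) : ℤ)

/-- The cornerless paths in `freePaths m r k` that touch `L_k` and do not start with a down step
(for odd `m`), respectively with an up step (for even `m`). -/
def touchingCornerlessFreePaths (m r k : ℕ) : Set LatticePath :=
  {P | P ∈ freePaths m r k ∧ P.Touches (boundaryLine k) ∧ P.Cornerless ∧
    (Odd m → P.steps.head? ≠ some Step.down) ∧ (Even m → P.steps.head? ≠ some Step.up)}

/-- The cornerless paths in `motzkinPrefixes m r k` that touch `y = k` and end with a flat step. -/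
def touchingCornerlessPrefixes (m r k : ℕ) : Set LatticePath :=
  {P | P ∈ motzkinPrefixes m r k ∧ P.Touches k ∧ P.Cornerless ∧
    P.steps.getLast? = some Step.flat}

/-- `F_c(m, r, k)`. -/
def cornerlessFreePaths (m r k : ℕ) : Set LatticePath :=
  ⋃ i ∈ Set.Iic k, touchingCornerlessFreePaths m r i

/-- `M_c(m, r, k)`. -/
def cornerlessPrefixes (m r k : ℕ) : Set LatticePath :=
  ⋃ i ∈ Set.Iic k, touchingCornerlessPrefixes m r i

/-- The cornerless symmetric Motzkin paths of length `2m + t - 1` with `t - 1` flat steps in the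
strip `0 ≤ y ≤ k`, with the equations for the length and for the number of flat steps written
additively. -/
def cornerlessSymmetricPaths (t m k : ℕ) : Set LatticePath :=
  {P | P.IsMotzkin ∧ P.IsSymmetric ∧ P.Cornerless ∧
    P.length + 1 = 2 * m + t ∧ P.flats + 1 = t ∧ P.InStrip 0 k}

end CoreMotzkin

/-! Everything is compared with the sequences (b). Between consecutive flat steps a cornerless path
is monotone, so it is determined by its endpoints and the heights of its flat steps, and its number
of non-flat steps is the total variation of these heights (`pathThrough`, `variation`). The union
over touched lines only says that the path stays in the strip for `k`. Hence (c) is (b) read as flat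
heights; for odd `m` the path starts at `1`, which saves one unit of the rise from `0` to `n_0 > 0`.

For (a), a diagram is encoded by its beads. Conjugation exchanges beads and gaps under `x ↦ -1 - x`,
hook lengths are differences between a bead and a smaller gap, and corners are beads `x` with `x -
1` a gap. For a `t`-core the beads in each residue class mod `t` form an initial segment; the ends
of these segments are antisymmetric under `i ↦ t - 1 - i`, and the first `⌊t/2⌋` of them are the
`n_i`. The largest bead gives the bounds on `n_i`. The corners are counted by positive parts of
cyclic differences, which add up to the total variation minus `[n_0 > 0]`
(`ncard_add_eq_variation`).

For `t ≥ 2`, deleting the last flat step in (d), or keeping the part of (e) before its central flat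
steps, leaves a cornerless path from `0` to an arbitrary height in `0, …, k`. These are matched with
(b) by counting. The generating function `kernel` is symmetric, invariant under reflection of the
strip, satisfies the discrete wave equation (`kernel_wave`), and has the boundary rule
`kernel_neg_one`. Together these move the sum over `n_0` from the centre of the strip to its
boundary: the entries `n_0 ≤ 0` account for the even final heights and the entries `n_0 > 0` for the
odd ones (`sum_kernel_middle`). -/

namespace CoreMotzkin

open Finset

/-! ### Cornerless paths and the heights of their flat steps -/

/-- The two-step patterns that a cornerless path may contain. -/
def Step.Smooth (a b : Step) : Prop := ¬ (a = .up ∧ b = .down) ∧ ¬ (a = .down ∧ b = .up)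

theorem cornerless_iff_isChain (s : ℤ) (w : List Step) :
    LatticePath.Cornerless ⟨s, w⟩ ↔ w.IsChain Step.Smooth := by
  rw [List.isChain_iff_getElem]
  constructor
  · intro h i hi
    have := h i
    simp only [List.getElem?_eq_getElem hi, List.getElem?_eq_getElem (Nat.lt_of_succ_lt hi),
      Option.some.injEq] at this
    exact this
  · intro h i
    by_cases hi : i + 1 < w.length
    · simp only [List.getElem?_eq_getElem hi, List.getElem?_eq_getElem (Nat.lt_of_succ_lt hi),
        Option.some.injEq]
      exact h i hi
    · simp [List.getElem?_eq_none (not_lt.1 hi)]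

/-- The total rise of a sequence of steps. -/
def rise (w : List Step) : ℤ := (w.map Step.rise).sum

@[simp] theorem rise_nil : rise [] = 0 := rfl

@[simp] theorem rise_cons (a : Step) (w : List Step) : rise (a :: w) = a.rise + rise w := by
  simp [rise]

@[simp] theorem rise_append (v w : List Step) : rise (v ++ w) = rise v + rise w := by
  simp [rise]

theorem height_length (s : ℤ) (w : List Step) :
    LatticePath.height ⟨s, w⟩ w.length = s + rise w := by
  simp [LatticePath.height, rise]

theorem inStrip_nil (s a b : ℤ) : LatticePath.InStrip ⟨s, []⟩ a b ↔ a ≤ s ∧ s ≤ b := by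
  simp [LatticePath.InStrip, LatticePath.height, LatticePath.length]

theorem inStrip_cons (s a b : ℤ) (x : Step) (w : List Step) :
    LatticePath.InStrip ⟨s, x :: w⟩ a b ↔
      (a ≤ s ∧ s ≤ b) ∧ LatticePath.InStrip ⟨s + x.rise, w⟩ a b := by
  simp only [LatticePath.InStrip, LatticePath.height, LatticePath.length]
  constructor
  · intro h
    refine ⟨by simpa using h 0 (by simp), fun i hi => ?_⟩
    have := h (i + 1) (by simpa using hi)
    simpa [add_assoc] using this
  · rintro ⟨h0, h⟩ i hi
    cases i with
    | zero => simpa using h0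
    | succ i =>
      have := h i (by simpa using hi)
      simpa [add_assoc] using this

theorem InStrip.start {s a b : ℤ} {w : List Step} (h : LatticePath.InStrip ⟨s, w⟩ a b) :
    a ≤ s ∧ s ≤ b := by
  simpa [LatticePath.height] using h 0 (Nat.zero_le _)

theorem inStrip_append (s a b : ℤ) (v w : List Step) :
    LatticePath.InStrip ⟨s, v ++ w⟩ a b ↔
      LatticePath.InStrip ⟨s, v⟩ a b ∧ LatticePath.InStrip ⟨s + rise v, w⟩ a b := by
  induction v generalizing s with
  | nil =>
    simp only [List.nil_append, rise_nil, add_zero, inStrip_nil]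
    exact ⟨fun h => ⟨InStrip.start h, h⟩, fun h => h.2⟩
  | cons x v ih => simp only [List.cons_append, inStrip_cons, ih, rise_cons, add_assoc, and_assoc]

/-- The heights of the flat steps. -/
def flatHeights : ℤ → List Step → List ℤ
  | _, [] => []
  | s, .up :: w => flatHeights (s + 1) w
  | s, .down :: w => flatHeights (s - 1) w
  | s, .flat :: w => s :: flatHeights s w

/-- The monotone path without flat steps from height `s` to height `e`. -/
def verticalSteps (s e : ℤ) : List Step :=
  if s ≤ e then List.replicate (e - s).toNat .up else List.replicate (s - e).toNat .down

/-- The cornerless path from height `s` to height `e` with flat steps at the given heights. -/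
def pathThrough : ℤ → List ℤ → ℤ → List Step
  | s, [], e => verticalSteps s e
  | s, h :: l, e => verticalSteps s h ++ .flat :: pathThrough h l e

/-- The total variation of the sequence `s, l, e`. -/
def variation : ℤ → List ℤ → ℤ → ℕ
  | s, [], e => (e - s).natAbs
  | s, h :: l, e => (h - s).natAbs + variation h l e

theorem verticalSteps_self (s : ℤ) : verticalSteps s s = [] := by simp [verticalSteps]

theorem verticalSteps_of_lt {s e : ℤ} (h : s < e) :
    verticalSteps s e = .up :: verticalSteps (s + 1) e := by
  have : (e - s).toNat = (e - (s + 1)).toNat + 1 := by omega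
  rw [verticalSteps, verticalSteps, if_pos h.le, if_pos (by omega), this, List.replicate_succ]

theorem verticalSteps_of_gt {s e : ℤ} (h : e < s) :
    verticalSteps s e = .down :: verticalSteps (s - 1) e := by
  have : (s - e).toNat = (s - 1 - e).toNat + 1 := by omega
  rw [verticalSteps, if_neg (by omega), this, List.replicate_succ, verticalSteps]
  split_ifs with h'
  · have h1 : (s - 1 - e).toNat = 0 := by omega
    have h2 : (e - (s - 1)).toNat = 0 := by omega
    rw [h1, h2]; rfl
  · rfl

theorem pathThrough_of_lt {s e : ℤ} {l : List ℤ} (h : s < l.headD e) :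
    pathThrough s l e = .up :: pathThrough (s + 1) l e := by
  cases l with
  | nil => exact verticalSteps_of_lt h
  | cons a l => simp only [pathThrough, verticalSteps_of_lt (show s < a from h), List.cons_append]

theorem pathThrough_of_gt {s e : ℤ} {l : List ℤ} (h : l.headD e < s) :
    pathThrough s l e = .down :: pathThrough (s - 1) l e := by
  cases l with
  | nil => exact verticalSteps_of_gt h
  | cons a l => simp only [pathThrough, verticalSteps_of_gt (show a < s from h), List.cons_append]

theorem pathThrough_cons_self (s e : ℤ) (l : List ℤ) :
    pathThrough s (s :: l) e = .flat :: pathThrough s l e := by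
  simp [pathThrough, verticalSteps_self]

theorem variation_of_lt {s e : ℤ} {l : List ℤ} (h : s < l.headD e) :
    variation s l e = variation (s + 1) l e + 1 := by
  cases l with
  | nil => simp only [variation, List.headD_nil] at *; omega
  | cons a l => simp only [variation, List.headD_cons] at *; omega

theorem variation_of_gt {s e : ℤ} {l : List ℤ} (h : l.headD e < s) :
    variation s l e = variation (s - 1) l e + 1 := by
  cases l with
  | nil => simp only [variation, List.headD_nil] at *; omega
  | cons a l => simp only [variation, List.headD_cons] at *; omega

/-- Induction along `pathThrough s l e`, one step at a time. -/
theorem pathThrough_induction {p : ℤ → List ℤ → Prop} (e : ℤ) (nil : p e [])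
    (flat : ∀ s l, p s l → p s (s :: l))
    (up : ∀ s l, s < l.headD e → p (s + 1) l → p s l)
    (down : ∀ s l, l.headD e < s → p (s - 1) l → p s l) (s : ℤ) (l : List ℤ) : p s l := by
  -- Inner induction on the distance to the next flat height, or to `e` if no flat step is left.
  have key : ∀ l, p (l.headD e) l → ∀ n : ℕ, ∀ s, (l.headD e - s).natAbs = n → p s l := by
    intro l hl n
    induction n with
    | zero =>
      intro s hs
      have : s = l.headD e := by omega
      exact this ▸ hl
    | succ n ih =>
      intro s hs
      rcases lt_trichotomy s (l.headD e) with h | h | h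
      · exact up s l h (ih _ (by omega))
      · omega
      · exact down s l h (ih _ (by omega))
  induction l generalizing s with
  | nil => exact key [] nil _ s rfl
  | cons a l ih => exact key (a :: l) (flat a l (ih a)) _ s rfl

theorem flatHeights_pathThrough (s : ℤ) (l : List ℤ) (e : ℤ) :
    flatHeights s (pathThrough s l e) = l := by
  induction s, l using pathThrough_induction e
  · simp [pathThrough, verticalSteps_self, flatHeights]
  · rename_i s l h; rw [pathThrough_cons_self, flatHeights, h]
  · rename_i s l hs h; rw [pathThrough_of_lt hs, flatHeights, h]
  · rename_i s l hs h; rw [pathThrough_of_gt hs, flatHeights, h]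

theorem rise_pathThrough (s : ℤ) (l : List ℤ) (e : ℤ) :
    s + rise (pathThrough s l e) = e := by
  induction s, l using pathThrough_induction e
  · simp [pathThrough, verticalSteps_self]
  · rename_i s l h; rw [pathThrough_cons_self, rise_cons, Step.rise]; omega
  · rename_i s l hs h; rw [pathThrough_of_lt hs, rise_cons, Step.rise]; omega
  · rename_i s l hs h; rw [pathThrough_of_gt hs, rise_cons, Step.rise]; omega

theorem length_pathThrough (s : ℤ) (l : List ℤ) (e : ℤ) :
    (pathThrough s l e).length = variation s l e + l.length := by
  induction s, l using pathThrough_induction e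
  · simp [pathThrough, verticalSteps_self, variation]
  · rename_i s l h; simp [pathThrough_cons_self, variation, h]; omega
  · rename_i s l hs h; rw [pathThrough_of_lt hs, variation_of_lt hs, List.length_cons, h]; omega
  · rename_i s l hs h; rw [pathThrough_of_gt hs, variation_of_gt hs, List.length_cons, h]; omega

theorem count_flat_eq_length_flatHeights (s : ℤ) (w : List Step) :
    w.count .flat = (flatHeights s w).length := by
  induction w generalizing s with
  | nil => rfl
  | cons a w ih => cases a <;> simp [flatHeights, ← ih]

theorem head?_pathThrough_eq_up (s : ℤ) (l : List ℤ) (e : ℤ) :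
    (pathThrough s l e).head? = some .up ↔ s < l.headD e := by
  rcases lt_trichotomy s (l.headD e) with h | h | h
  · simp [-List.headD_eq_head?_getD, pathThrough_of_lt h, h]
  · cases l <;> simp at h <;> subst h <;> simp [pathThrough, verticalSteps_self]
  · simp [-List.headD_eq_head?_getD, pathThrough_of_gt h, h.le]

theorem head?_pathThrough_eq_down (s : ℤ) (l : List ℤ) (e : ℤ) :
    (pathThrough s l e).head? = some .down ↔ l.headD e < s := by
  rcases lt_trichotomy s (l.headD e) with h | h | h
  · simp [-List.headD_eq_head?_getD, pathThrough_of_lt h, h.le]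
  · cases l <;> simp at h <;> subst h <;> simp [pathThrough, verticalSteps_self]
  · simp [-List.headD_eq_head?_getD, pathThrough_of_gt h, h]

theorem isChain_pathThrough (s : ℤ) (l : List ℤ) (e : ℤ) :
    (pathThrough s l e).IsChain Step.Smooth := by
  induction s, l using pathThrough_induction e
  · simp [pathThrough, verticalSteps_self]
  · rename_i s l h
    rw [pathThrough_cons_self, List.isChain_cons]
    exact ⟨by simp [Step.Smooth], h⟩
  · rename_i s l hs h
    rw [pathThrough_of_lt hs, List.isChain_cons]
    refine ⟨fun y hy => ?_, h⟩
    have := (head?_pathThrough_eq_down (s + 1) l e).not.2 (by omega)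
    refine ⟨?_, by simp⟩
    rintro ⟨-, rfl⟩
    exact this hy
  · rename_i s l hs h
    rw [pathThrough_of_gt hs, List.isChain_cons]
    refine ⟨fun y hy => ?_, h⟩
    have := (head?_pathThrough_eq_up (s - 1) l e).not.2 (by omega)
    refine ⟨by simp, ?_⟩
    rintro ⟨-, rfl⟩
    exact this hy

/-- After an up step the rest cannot begin with a down step, so its next flat height or endpoint is
not below its start; thus `pathThrough` also begins with an up step. Down steps are symmetric. -/
theorem pathThrough_flatHeights {w : List Step} (hw : w.IsChain Step.Smooth) (s : ℤ) :
    pathThrough s (flatHeights s w) (s + rise w) = w := by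
  induction w generalizing s with
  | nil => simp [flatHeights, pathThrough, verticalSteps_self]
  | cons a w ih =>
    rw [List.isChain_cons] at hw
    obtain ⟨h1, h2⟩ := hw
    cases a with
    | up =>
      have ih' := ih h2 (s + 1)
      have hd := (head?_pathThrough_eq_down (s + 1) (flatHeights (s + 1) w) (s + 1 + rise w))
      rw [ih'] at hd
      have : ¬ w.head? = some .down := fun h => (h1 _ h).1 ⟨rfl, rfl⟩
      rw [flatHeights, rise_cons, Step.rise, ← add_assoc, pathThrough_of_lt, ih']
      rw [hd] at this
      omega
    | down =>
      have ih' := ih h2 (s - 1)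
      have hd := (head?_pathThrough_eq_up (s - 1) (flatHeights (s - 1) w) (s - 1 + rise w))
      rw [ih'] at hd
      have : ¬ w.head? = some .up := fun h => (h1 _ h).2 ⟨rfl, rfl⟩
      rw [flatHeights, rise_cons, Step.rise, ← add_assoc, ← sub_eq_add_neg, pathThrough_of_gt, ih']
      rw [hd] at this
      omega
    | flat => simp [flatHeights, pathThrough_cons_self, Step.rise, ih h2 s]

/-- The pieces between flat steps are monotone, so extreme heights occur at the endpoints or at flat
steps. -/
theorem inStrip_pathThrough (s : ℤ) (l : List ℤ) (e a b : ℤ) :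
    LatticePath.InStrip ⟨s, pathThrough s l e⟩ a b ↔
      (a ≤ s ∧ s ≤ b) ∧ (a ≤ e ∧ e ≤ b) ∧ ∀ h ∈ l, a ≤ h ∧ h ≤ b := by
  induction s, l using pathThrough_induction e
  · simp [pathThrough, verticalSteps_self, inStrip_nil]
  · rename_i s l h
    rw [pathThrough_cons_self, inStrip_cons]
    simp only [Step.rise, add_zero, h, List.forall_mem_cons]
    tauto
  · rename_i s l hs h
    rw [pathThrough_of_lt hs, inStrip_cons]
    simp only [Step.rise, h]
    cases l with
    | nil => simp at hs ⊢; omega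
    | cons x l => simp at hs ⊢; grind
  · rename_i s l hs h
    rw [pathThrough_of_gt hs, inStrip_cons]
    simp only [Step.rise, ← sub_eq_add_neg, h]
    cases l with
    | nil => simp at hs ⊢; omega
    | cons x l => simp at hs ⊢; grind

/-- This ties the parity of `m` to the sign of `n_0` in (b) and to the starting height in (c). -/
theorem variation_parity (s : ℤ) (l : List ℤ) (e : ℤ) :
    (variation s l e : ℤ) % 2 = (e - s) % 2 := by
  induction l generalizing s with
  | nil => simp only [variation]; omega
  | cons a l ih => have := ih a; simp only [variation]; omega

theorem variation_ofFn (g : ℕ → ℤ) (r : ℕ) :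
    (variation (g 0) (List.ofFn fun i : Fin r => g (i + 1)) (g (r + 1)) : ℤ) =
      ∑ i ∈ range (r + 1), |g (i + 1) - g i| := by
  induction r generalizing g with
  | zero => simp [variation]
  | succ r ih =>
    rw [List.ofFn_succ, variation, sum_range_succ', ← ih fun i => g (i + 1)]
    simp [add_comm]

/-! ### The sets of paths, without the decomposition by touched lines -/

/-- Passing from strip `i` to strip `i + 1` adds exactly the line `L_{i+1}`, so a path touches `L_i`
for the smallest strip that contains it. -/
theorem mem_cornerlessFreePaths (m r k : ℕ) (P : LatticePath) :
    P ∈ cornerlessFreePaths m r k ↔ P ∈ freePaths m r k ∧ P.Cornerless ∧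
      (Odd m → P.steps.head? ≠ some Step.down) ∧ (Even m → P.steps.head? ≠ some Step.up) := by
  simp only [cornerlessFreePaths, Set.mem_iUnion, Set.mem_Iic, touchingCornerlessFreePaths,
    Set.mem_ofPred_eq, exists_prop]
  constructor
  · rintro ⟨i, hi, ⟨h1, h2, h3, h4⟩, -, h5⟩
    refine ⟨⟨h1, h2, h3, fun j hj => ?_⟩, h5⟩
    have := h4 j hj
    constructor <;> omega
  · rintro ⟨⟨h1, h2, h3, h4⟩, h5⟩
    induction k with
    | zero =>
      refine ⟨0, le_rfl, ⟨h1, h2, h3, h4⟩, ⟨_, le_rfl, ?_⟩, h5⟩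
      simpa [boundaryLine] using h1.2
    | succ k ih =>
      by_cases ht : P.Touches (boundaryLine (k + 1))
      · exact ⟨k + 1, le_rfl, ⟨h1, h2, h3, h4⟩, ht, h5⟩
      · obtain ⟨i, hi, h⟩ := ih fun j hj => by
          have hne : P.height j ≠ boundaryLine (k + 1) := fun h => ht ⟨j, hj, h⟩
          have := h4 j hj
          simp only [boundaryLine] at hne
          split_ifs at hne with ho
          · obtain ⟨c, hc⟩ := ho
            constructor <;> omega
          · obtain ⟨c, hc⟩ := Nat.not_odd_iff_even.1 ho
            constructor <;> omega
        exact ⟨i, hi.trans (Nat.le_succ k), h⟩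

theorem mem_cornerlessPrefixes (m r k : ℕ) (P : LatticePath) :
    P ∈ cornerlessPrefixes m r k ↔ P.start = 0 ∧ P.length = m + r ∧ P.flats = r ∧
      P.InStrip 0 k ∧ P.Cornerless ∧ P.steps.getLast? = some Step.flat := by
  simp only [cornerlessPrefixes, Set.mem_iUnion, Set.mem_Iic, touchingCornerlessPrefixes,
    motzkinPrefixes, LatticePath.IsMotzkinPrefix, Set.mem_ofPred_eq, exists_prop]
  constructor
  · rintro ⟨i, hi, ⟨h1, h2, h3, h4⟩, -, h5⟩
    refine ⟨h1.1, h2, h3, fun j hj => ?_, h5⟩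
    have := h4 j hj
    constructor <;> omega
  · rintro ⟨h1, h2, h3, h4, h5⟩
    induction k with
    | zero =>
      refine ⟨0, le_rfl, ⟨⟨h1, fun i hi => (h4 i hi).1⟩, h2, h3, h4⟩, ⟨0, Nat.zero_le _, ?_⟩, h5⟩
      simp [LatticePath.height, h1]
    | succ k ih =>
      by_cases ht : P.Touches ((k + 1 : ℕ) : ℤ)
      · exact ⟨k + 1, le_rfl, ⟨⟨h1, fun i hi => (h4 i hi).1⟩, h2, h3, h4⟩, ht, h5⟩
      · obtain ⟨i, hi, h⟩ := ih fun j hj => by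
          have hne : P.height j ≠ ((k + 1 : ℕ) : ℤ) := fun h => ht ⟨j, hj, h⟩
          have := h4 j hj
          constructor <;> omega
        exact ⟨i, hi.trans (Nat.le_succ k), h⟩

section Counting

open Polynomial

/-! ### Sequences in an interval, counted by total variation -/

/-- Prepending `lo + i` to a list. -/
def consEmbedding (lo : ℤ) : ℕ × List ℤ ↪ List ℤ :=
  ⟨fun p => (lo + (p.1 : ℤ)) :: p.2, by rintro ⟨a, l⟩ ⟨b, l'⟩ h; simpa using h⟩

theorem consEmbedding_apply (lo : ℤ) (i : ℕ) (l : List ℤ) :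
    consEmbedding lo (i, l) = (lo + (i : ℤ)) :: l := rfl

/-- The lists of length `r` with entries in `lo, …, lo + k`. -/
def boundedLists (lo : ℤ) (k : ℕ) : ℕ → Finset (List ℤ)
  | 0 => {[]}
  | r + 1 => (range (k + 1) ×ˢ boundedLists lo k r).map (consEmbedding lo)

theorem mem_boundedLists (lo : ℤ) (k r : ℕ) (l : List ℤ) :
    l ∈ boundedLists lo k r ↔ l.length = r ∧ ∀ h ∈ l, lo ≤ h ∧ h ≤ lo + k := by
  induction r generalizing l with
  | zero => simp +contextual [boundedLists]
  | succ r ih =>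
    simp only [boundedLists, mem_map, mem_product, Finset.mem_range, ih, consEmbedding_apply,
      Prod.exists]
    constructor
    · rintro ⟨a, l, ⟨ha, hl, hb⟩, rfl⟩
      refine ⟨by simp [hl], ?_⟩
      simp only [List.forall_mem_cons]
      exact ⟨by omega, hb⟩
    · rintro ⟨hl, hb⟩
      cases l with
      | nil => simp at hl
      | cons x l =>
        simp only [List.forall_mem_cons] at hb
        exact ⟨(x - lo).toNat, l, ⟨by omega, by simpa using hl, hb.2⟩, by congr 1; omega⟩

/-- The generating function by total variation of the sequences `i, h_1, …, h_r, j` with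
`0 ≤ h_1, …, h_r ≤ k`. -/
noncomputable def kernel (k : ℕ) : ℕ → ℤ → ℤ → ℤ[X]
  | 0, i, j => X ^ (i - j).natAbs
  | r + 1, i, j => ∑ l ∈ range (k + 1), X ^ (i - l).natAbs * kernel k r l j

theorem sum_boundedLists (lo : ℤ) (k r : ℕ) (i j : ℤ) :
    ∑ l ∈ boundedLists lo k r, (X : ℤ[X]) ^ variation (lo + i) l (lo + j) = kernel k r i j := by
  induction r generalizing i with
  | zero =>
    simp only [boundedLists, sum_singleton, variation, kernel]
    congr 1; omega
  | succ r ih =>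
    simp only [boundedLists, sum_map, sum_product, kernel, consEmbedding_apply, variation,
      pow_add, ← mul_sum, ih]
    refine sum_congr rfl fun l _ => ?_
    congr 2; omega

/-! ### Symmetries of the kernel and the discrete wave equation -/

theorem kernel_succ' (k r : ℕ) (i j : ℤ) :
    kernel k (r + 1) i j = ∑ l ∈ range (k + 1), kernel k r i l * X ^ ((l : ℤ) - j).natAbs := by
  induction r generalizing i with
  | zero => simp only [kernel]
  | succ r ih =>
    rw [kernel]
    simp only [ih]
    simp only [kernel, mul_sum, sum_mul]
    rw [sum_comm]
    simp only [mul_assoc]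

theorem kernel_symm (k r : ℕ) (i j : ℤ) : kernel k r i j = kernel k r j i := by
  induction r generalizing i j with
  | zero => simp only [kernel]; congr 1; omega
  | succ r ih =>
    rw [kernel_succ', kernel]
    refine sum_congr rfl fun l _ => ?_
    rw [ih, mul_comm]
    congr 2; omega

theorem kernel_reflect (k r : ℕ) (i j : ℤ) :
    kernel k r (k - i) (k - j) = kernel k r i j := by
  induction r generalizing i with
  | zero => simp only [kernel]; congr 1; omega
  | succ r ih =>
    rw [kernel, kernel, ← sum_range_reflect]
    refine sum_congr rfl fun l hl => ?_
    rw [Finset.mem_range] at hl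
    rw [← ih]
    congr 2 <;> omega

/-- Every height in the strip is one unit farther from `-1` than from `0`. This is the boundary
condition for the wave equation. -/
theorem kernel_neg_one (k r : ℕ) {j : ℤ} (hj : 0 ≤ j) :
    kernel k r (-1) j = X * kernel k r 0 j := by
  cases r with
  | zero => simp only [kernel]; rw [← pow_succ']; congr 1; omega
  | succ r =>
    simp only [kernel, mul_sum, ← mul_assoc, ← pow_succ']
    refine sum_congr rfl fun l _ => ?_
    congr 2; omega

/-- As a function of `i`, `X ^ |i - l|` is annihilated by the three-term operator `X * (shift up +
shift down) - (1 + X ^ 2)` except at `i = l`, where the value is `-(1 - X ^ 2)`. -/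
theorem kernel_recurrence (k r : ℕ) {i : ℕ} (hi : i ≤ k) (j : ℤ) :
    X * (kernel k (r + 1) (i + 1) j + kernel k (r + 1) (i - 1) j) =
      (1 + X ^ 2) * kernel k (r + 1) i j - (1 - X ^ 2) * kernel k r i j := by
  have h : (1 - X ^ 2) * kernel k r i j =
      ∑ l ∈ range (k + 1), if l = i then (1 - X ^ 2) * kernel k r l j else 0 := by
    rw [sum_ite_eq' (range (k + 1)) i fun l : ℕ => (1 - (X : ℤ[X]) ^ 2) * kernel k r l j,
      if_pos (Finset.mem_range.2 (by omega))]
  rw [h, kernel, kernel, kernel, ← sum_add_distrib, mul_sum, mul_sum, ← sum_sub_distrib]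
  refine sum_congr rfl fun l _ => ?_
  rcases lt_trichotomy l i with h | h | h
  · rw [if_neg h.ne]
    obtain ⟨d, rfl⟩ := Nat.exists_eq_add_of_lt h
    rw [show (((l + d + 1 : ℕ) : ℤ) + 1 - l).natAbs = d + 2 by omega,
      show (((l + d + 1 : ℕ) : ℤ) - 1 - l).natAbs = d by omega,
      show (((l + d + 1 : ℕ) : ℤ) - l).natAbs = d + 1 by omega]
    ring
  · subst h
    rw [if_pos rfl, show ((l : ℤ) + 1 - l).natAbs = 1 by omega,
      show ((l : ℤ) - 1 - l).natAbs = 1 by omega, show ((l : ℤ) - l).natAbs = 0 by omega]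
    ring
  · rw [if_neg h.ne']
    obtain ⟨d, rfl⟩ := Nat.exists_eq_add_of_lt h
    rw [show ((i : ℤ) + 1 - (i + d + 1 : ℕ)).natAbs = d by omega,
      show ((i : ℤ) - 1 - (i + d + 1 : ℕ)).natAbs = d + 2 by omega,
      show ((i : ℤ) - (i + d + 1 : ℕ)).natAbs = d + 1 by omega]
    ring

/-- The kernel satisfies the discrete wave equation. -/
theorem kernel_wave (k r : ℕ) {i j : ℕ} (hi : i ≤ k) (hj : j ≤ k) :
    kernel k r (i + 1) j + kernel k r (i - 1) j = kernel k r i (j + 1) + kernel k r i (j - 1) := by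
  cases r with
  | zero =>
    simp only [kernel]
    rw [add_comm]
    congr 2 <;> omega
  | succ r =>
    apply mul_left_cancel₀ (X_ne_zero (R := ℤ))
    rw [kernel_recurrence k r hi, kernel_symm k _ i (j + 1), kernel_symm k _ i (j - 1),
      kernel_recurrence k r hj, kernel_symm k _ j i, kernel_symm k _ j i]

/-- The wave equation at `(c, b + 1)` turns the left side into the same difference at `(c - 1, b +
1)`. Iterating reaches `c = 0`, where `kernel_neg_one` evaluates the term outside the strip. -/
theorem kernel_diagonal (k r : ℕ) (c b : ℕ) (h : c + b + 1 ≤ k) :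
    kernel k r (c + 1 : ℕ) (b + 1 : ℕ) - kernel k r c b =
      kernel k r 0 (c + b + 2 : ℕ) - X * kernel k r 0 (c + b + 1 : ℕ) := by
  have hw := kernel_wave k r (i := c) (j := b + 1) (by omega) (by omega)
  induction c generalizing b with
  | zero =>
    rw [Nat.cast_zero, zero_sub, kernel_neg_one k r (by omega)] at hw
    push_cast at hw ⊢
    simp only [add_sub_cancel_right, zero_add, add_assoc, one_add_one_eq_two] at hw ⊢
    linear_combination hw
  | succ c ih =>
    have := ih (b + 1) (by omega) (kernel_wave k r (by omega) (by omega))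
    push_cast at hw this ⊢
    rw [show (c : ℤ) + (b + 1) + 2 = c + 1 + b + 2 by ring,
      show (c : ℤ) + (b + 1) + 1 = c + 1 + b + 1 by ring] at this
    rw [add_sub_cancel_right, add_sub_cancel_right] at hw
    linear_combination hw + this

/-- The sum of `X ^ (c - 1 - j) * kernel k r j b` over `0 ≤ j < c`. -/
theorem sum_pow_mul_kernel (k r : ℕ) (c b : ℕ) (hcb : c ≤ b + 1) (h : c + b ≤ k + 1) :
    ∑ j ∈ range c, X ^ (c - 1 - j) * kernel k r j b =
      ∑ l ∈ range c, kernel k r 0 (b + 1 - c + 2 * l : ℕ) := by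
  have hrec : ∀ c b : ℕ, ∑ j ∈ range (c + 1), (X : ℤ[X]) ^ (c - j) * kernel k r j b =
      kernel k r c b + X * ∑ j ∈ range c, X ^ (c - 1 - j) * kernel k r j b := by
    intro c b
    rw [sum_range_succ, Nat.sub_self, pow_zero, one_mul, mul_sum, add_comm]
    congr 1
    refine sum_congr rfl fun j hj => ?_
    rw [Finset.mem_range] at hj
    rw [← mul_assoc, ← pow_succ']
    congr 2; omega
  -- Raising `c` and `b` together adds a single boundary term: the multiple of `X` in
  -- `kernel_diagonal` cancels the one produced by `hrec`.
  have hdiff : ∀ c b : ℕ, c + b ≤ k →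
      ∑ j ∈ range (c + 1), X ^ (c - j) * kernel k r j (b + 1 : ℕ) =
        ∑ j ∈ range c, X ^ (c - 1 - j) * kernel k r j b + kernel k r 0 (c + b + 1 : ℕ) := by
    intro c
    induction c with
    | zero => intro b _; simp
    | succ c ih =>
      intro b hb
      have hd := kernel_diagonal k r c b (by omega)
      rw [hrec (c + 1), Nat.add_sub_cancel, ih b (by omega), hrec c b]
      rw [show c + 1 + b + 1 = c + b + 2 by ring]
      linear_combination hd
  induction c generalizing b with
  | zero => simp
  | succ c ih =>
    rw [Nat.add_sub_cancel]
    cases b with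
    | zero =>
      obtain rfl : c = 0 := by omega
      simp
    | succ b =>
      rw [hdiff c b (by omega), ih b (by omega) (by omega), sum_range_succ]
      congr 2
      · funext l
        congr 2; omega
      · congr 1; omega

theorem sum_range_even_odd {M : Type*} [AddCommMonoid M] (f : ℕ → M) (k : ℕ) :
    ∑ l ∈ range (k / 2 + 1), f (2 * l) + ∑ l ∈ range (k - k / 2), f (2 * l + 1) =
      ∑ l ∈ range (k + 1), f l := by
  induction k with
  | zero => simp
  | succ k ih =>
    rw [sum_range_succ _ (k + 1), ← ih]
    rcases Nat.even_or_odd' k with ⟨c, rfl | rfl⟩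
    · rw [show (2 * c + 1) / 2 = c by omega, show 2 * c / 2 = c by omega,
        show 2 * c + 1 - c = c + 1 by omega, show 2 * c - c = c by omega, sum_range_succ _ c,
        sum_range_succ _ c]
      abel
    · rw [show (2 * c + 1 + 1) / 2 = c + 1 by omega, show (2 * c + 1) / 2 = c by omega,
        show 2 * c + 1 + 1 - (c + 1) = c + 1 by omega, show 2 * c + 1 - c = c + 1 by omega,
        sum_range_succ _ (c + 1), show 2 * (c + 1) = 2 * c + 1 + 1 by ring]
      abel

/-- Paths that end near the middle of the strip are equinumerous to paths that start at its
boundary. -/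
theorem sum_kernel_middle (k r : ℕ) :
    ∑ j ∈ range (k + 1), X ^ (if j ≤ k / 2 then k / 2 - j else j - k / 2 - 1) *
        kernel k r j (k / 2 : ℕ) = ∑ j ∈ range (k + 1), kernel k r 0 j := by
  -- `h1` treats `j ≤ k / 2` and yields the even final heights; `h2` treats the upper half after the
  -- reflection `j ↦ k - j` and yields the odd ones.
  have h1 := sum_pow_mul_kernel k r (k / 2 + 1) (k / 2) le_rfl (by omega)
  have h2 := sum_pow_mul_kernel k r (k - k / 2) (k - k / 2) (by omega) (by omega)
  rw [← sum_range_even_odd fun j : ℕ => kernel k r 0 j,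
    ← sum_range_add_sum_Ico _ (show k / 2 + 1 ≤ k + 1 by omega)]
  congr 1
  · refine Eq.trans (sum_congr rfl fun j hj => ?_) (h1.trans (sum_congr rfl fun j hj => ?_))
    · rw [Finset.mem_range] at hj
      rw [if_pos (by omega)]
      rfl
    · congr 2; omega
  · refine Eq.trans ?_ (h2.trans (sum_congr rfl fun j hj => ?_))
    · rw [sum_Ico_eq_sum_range, show k + 1 - (k / 2 + 1) = k - k / 2 by omega,
        ← sum_range_reflect]
      refine sum_congr rfl fun j hj => ?_
      rw [Finset.mem_range] at hj
      rw [if_neg (by omega), ← kernel_reflect]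
      congr 2 <;> omega
    · congr 2; omega

/-- The pairs of a starting height and a list of further heights, with the total variation
adapted to half-integral centre. -/
def middlePairs (k r m : ℕ) : Finset (ℕ × List ℤ) :=
  (range (k + 1) ×ˢ boundedLists (-(k / 2 : ℕ)) k r).filter fun p =>
    (if p.1 ≤ k / 2 then k / 2 - p.1 else p.1 - k / 2 - 1) +
      variation (-(k / 2 : ℕ) + p.1) p.2 0 = m

/-- The pairs of a final height and a list of heights before. -/
def boundaryPairs (k r m : ℕ) : Finset (ℕ × List ℤ) :=
  (range (k + 1) ×ˢ boundedLists 0 k r).filter fun p => variation 0 p.2 p.1 = m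

theorem card_filter_eq_coeff {α : Type*} (s : Finset α) (f : α → ℕ) (m : ℕ) :
    ((s.filter fun a => f a = m).card : ℤ) = (∑ a ∈ s, (X : ℤ[X]) ^ f a).coeff m := by
  rw [finsetSum_coeff, card_filter]
  push_cast
  refine sum_congr rfl fun a _ => ?_
  rw [coeff_X_pow]
  congr 1
  exact propext eq_comm

/-- The two cardinalities are the coefficients of `X ^ m` on the two sides of `sum_kernel_middle`.
-/
theorem card_middlePairs (k r m : ℕ) : (middlePairs k r m).card = (boundaryPairs k r m).card := by
  rw [← Nat.cast_inj (R := ℤ), middlePairs, boundaryPairs, card_filter_eq_coeff,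
    card_filter_eq_coeff]
  congr 1
  have h0 : ∀ (j : ℕ), ∑ l ∈ boundedLists 0 k r, (X : ℤ[X]) ^ variation 0 l j =
      kernel k r 0 j := by
    intro j
    simpa using sum_boundedLists 0 k r 0 j
  have h1 : ∀ (j : ℕ), ∑ l ∈ boundedLists (-(k / 2 : ℕ)) k r,
      (X : ℤ[X]) ^ variation (-(k / 2 : ℕ) + j) l 0 = kernel k r j (k / 2 : ℕ) := by
    intro j
    simpa using sum_boundedLists (-(k / 2 : ℕ)) k r j (k / 2 : ℕ)
  simp only [sum_product, pow_add, ← mul_sum, h0, h1, sum_kernel_middle]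

end Counting

/-! ### Young diagrams as sets of beads -/

theorem hookLength_eq (μ : YoungDiagram) {i j : ℕ} (h : (i, j) ∈ μ) :
    (hookLength μ i j : ℤ) = μ.rowLen i - j + μ.colLen j - i - 1 := by
  have h1 := YoungDiagram.mem_iff_lt_rowLen.1 h
  have h2 := YoungDiagram.mem_iff_lt_colLen.1 h
  have : μ.cells.filter (fun c => (c.1 = i ∧ j ≤ c.2) ∨ (c.2 = j ∧ i ≤ c.1)) =
      {i} ×ˢ Ico j (μ.rowLen i) ∪ Ico (i + 1) (μ.colLen j) ×ˢ {j} := by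
    ext ⟨a, b⟩
    simp only [mem_filter, YoungDiagram.mem_cells, mem_union, mem_product, Finset.mem_Ico,
      mem_singleton]
    constructor
    · rintro ⟨hm, ⟨rfl, hb⟩ | ⟨rfl, ha⟩⟩
      · exact Or.inl ⟨rfl, hb, YoungDiagram.mem_iff_lt_rowLen.1 hm⟩
      · rcases ha.eq_or_lt with rfl | ha
        · exact Or.inl ⟨rfl, le_rfl, h1⟩
        · exact Or.inr ⟨⟨ha, YoungDiagram.mem_iff_lt_colLen.1 hm⟩, rfl⟩
    · rintro (⟨rfl, hc, hc'⟩ | ⟨⟨hc, hc'⟩, rfl⟩)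
      · exact ⟨YoungDiagram.mem_iff_lt_rowLen.2 hc', Or.inl ⟨rfl, hc⟩⟩
      · exact ⟨YoungDiagram.mem_iff_lt_colLen.2 hc', Or.inr ⟨rfl, by omega⟩⟩
  rw [hookLength, this, card_union_of_disjoint]
  · simp only [card_product, card_singleton, Nat.card_Ico]
    omega
  · rw [Finset.disjoint_left]
    rintro ⟨a, b⟩ ha hb
    simp only [mem_product, Finset.mem_Ico, mem_singleton] at ha hb
    omega

/-- The beads of a Young diagram: the vertical boundary steps, labelled by content. -/
def beads (μ : YoungDiagram) : Set ℤ := {x | ∃ i : ℕ, x = μ.rowLen i - i - 1}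

theorem lt_iff_lt_colLen (μ : YoungDiagram) (i j : ℕ) : j < μ.rowLen i ↔ i < μ.colLen j := by
  rw [← YoungDiagram.mem_iff_lt_rowLen, ← YoungDiagram.mem_iff_lt_colLen]

/-- Each integer labels exactly one boundary step; those that are not beads label the horizontal
steps, one for each column. -/
theorem notMem_beads_iff (μ : YoungDiagram) (x : ℤ) :
    x ∉ beads μ ↔ ∃ j : ℕ, x = j - μ.colLen j := by
  constructor
  · intro hx
    -- Take the first row `i` whose bead is at most `x`. If `x` is not that bead, column `x + i`
    -- meets exactly the rows before `i`.
    have hex : ∃ i : ℕ, (μ.rowLen i : ℤ) - i - 1 ≤ x := by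
      refine ⟨(μ.rowLen 0 - 1 - x).toNat, ?_⟩
      have := μ.rowLen_anti 0 (μ.rowLen 0 - 1 - x).toNat (Nat.zero_le _)
      omega
    classical
    have hi := Nat.find_spec hex
    have hmin := fun i => Nat.find_min hex (m := i)
    set i := Nat.find hex
    have hne : (μ.rowLen i : ℤ) - i - 1 ≠ x := fun h => hx ⟨i, h.symm⟩
    refine ⟨(x + i).toNat, ?_⟩
    have h1 : ¬ i < μ.colLen (x + i).toNat := by
      rw [← lt_iff_lt_colLen]; omega
    have h2 : ∀ i', i' + 1 = i → i' < μ.colLen (x + i).toNat := by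
      intro i' hi'
      have := hmin i' (by omega)
      rw [← lt_iff_lt_colLen]
      omega
    rcases i with _ | i'
    · omega
    · have := h2 i' rfl
      omega
  · rintro ⟨j, rfl⟩ ⟨i, hi⟩
    have := lt_iff_lt_colLen μ i j
    omega

theorem IsSelfConjugate.colLen_eq {μ : YoungDiagram} (h : IsSelfConjugate μ) (j : ℕ) :
    μ.colLen j = μ.rowLen j := by
  conv_lhs => rw [← h]
  exact μ.colLen_transpose j

theorem IsSelfConjugate.mem_beads_iff {μ : YoungDiagram} (h : IsSelfConjugate μ) (x : ℤ) :
    x ∈ beads μ ↔ -1 - x ∉ beads μ := by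
  rw [notMem_beads_iff]
  simp only [h.colLen_eq]
  constructor
  · rintro ⟨i, rfl⟩; exact ⟨i, by ring⟩
  · rintro ⟨i, hi⟩; exact ⟨i, by linarith⟩

/-- The hook length of `(i, j)` is the bead of row `i` minus the gap of column `j`. -/
theorem isCore_iff (μ : YoungDiagram) {t : ℕ} (ht : 1 ≤ t) :
    IsCore t μ ↔ ∀ x ∈ beads μ, x - t ∈ beads μ := by
  constructor
  · rintro h x ⟨i, rfl⟩
    by_contra hx
    obtain ⟨j, hj⟩ := (notMem_beads_iff _ _).1 hx
    have hlt := lt_iff_lt_colLen μ i j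
    have hm : (i, j) ∈ μ := YoungDiagram.mem_iff_lt_rowLen.2 (by omega)
    have := hookLength_eq μ hm
    exact h i j hm (by omega)
  · intro h i j hm ht'
    have := hookLength_eq μ hm
    exact (notMem_beads_iff μ (j - μ.colLen j)).2 ⟨j, rfl⟩
      (by convert h _ ⟨i, rfl⟩ using 1; omega)

theorem mem_innerCorners_iff (μ : YoungDiagram) (i j : ℕ) :
    (i, j) ∈ innerCorners μ ↔ μ.rowLen i = j + 1 ∧ μ.colLen j = i + 1 := by
  have hlt := lt_iff_lt_colLen μ
  constructor
  · rintro ⟨hm, hl⟩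
    have h1 := YoungDiagram.mem_iff_lt_rowLen.1 hm
    have h2 := YoungDiagram.mem_iff_lt_colLen.1 hm
    constructor
    · by_contra hne
      have : (i, j + 1) ∈ μ := YoungDiagram.mem_iff_lt_rowLen.2 (by omega)
      have := hl (a := (i, j + 1)) (b := (i, j)) (by simp) (by simpa using this)
      simp at this
    · by_contra hne
      have : (i + 1, j) ∈ μ := YoungDiagram.mem_iff_lt_colLen.2 (by omega)
      have := hl (a := (i + 1, j)) (b := (i, j)) (by simp) (by simpa using this)
      simp at this
  · rintro ⟨h1, h2⟩
    refine ⟨YoungDiagram.mem_iff_lt_rowLen.2 (by omega), ?_⟩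
    rintro ⟨a, b⟩ ⟨c, d⟩ ⟨hca, hdb⟩ ha
    simp only [coe_erase, Set.mem_sdiff, Set.mem_singleton_iff, Prod.mk.injEq, SetLike.mem_coe,
      YoungDiagram.mem_cells] at ha ⊢ hca hdb
    refine ⟨μ.up_left_mem hca hdb ha.1, ?_⟩
    rintro ⟨rfl, rfl⟩
    have h3 := μ.up_left_mem le_rfl hdb (μ.up_left_mem hca le_rfl ha.1)
    have h4 := YoungDiagram.mem_iff_lt_rowLen.1 (μ.up_left_mem hca le_rfl ha.1)
    have h5 := YoungDiagram.mem_iff_lt_colLen.1 (μ.up_left_mem le_rfl hdb ha.1)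
    exact ha.2 ⟨by omega, by omega⟩

/-- A corner is sent to its content `j - i`: its row has bead `j - i` and its column has gap `j - i
- 1`. -/
theorem ncard_innerCorners (μ : YoungDiagram) :
    (innerCorners μ).ncard = {x | x ∈ beads μ ∧ x - 1 ∉ beads μ}.ncard := by
  refine Set.ncard_congr (fun c _ => (c.2 : ℤ) - c.1) ?_ ?_ ?_
  · rintro ⟨i, j⟩ h
    rw [mem_innerCorners_iff] at h
    exact ⟨⟨i, by rw [h.1]; push_cast; ring⟩,
      (notMem_beads_iff _ _).2 ⟨j, by rw [h.2]; push_cast; ring⟩⟩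
  · rintro ⟨i, j⟩ ⟨i', j'⟩ h h' heq
    rw [mem_innerCorners_iff] at h h'
    have h1 := lt_iff_lt_colLen μ i j'
    have h2 := lt_iff_lt_colLen μ i' j
    simp only [Prod.mk.injEq] at heq ⊢
    omega
  · rintro x ⟨⟨i, hi⟩, hx⟩
    obtain ⟨j, hj⟩ := (notMem_beads_iff _ _).1 hx
    have hlt := lt_iff_lt_colLen μ i j
    have hc : μ.rowLen i = j + 1 ∧ μ.colLen j = i + 1 := by omega
    refine ⟨(i, j), (mem_innerCorners_iff μ i j).2 hc, ?_⟩
    simp only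
    omega

/-- The largest bead is `x = μ.rowLen 0 - 1`, and the first hook has length `2 * x + 1`. For the
empty diagram all beads are negative, so both sides hold. -/
theorem IsSelfConjugate.hookLength_lt_iff {μ : YoungDiagram} (h : IsSelfConjugate μ) (b : ℕ) :
    ((0, 0) ∈ μ → hookLength μ 0 0 < b) ↔ ∀ x ∈ beads μ, 2 * x + 1 < b := by
  constructor
  · rintro hb x ⟨i, rfl⟩
    have hanti := μ.rowLen_anti 0 i (Nat.zero_le _)
    by_cases hm : (0, 0) ∈ μ
    · have h1 := hookLength_eq μ hm
      rw [h.colLen_eq] at h1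
      have := hb hm
      push_cast at h1
      omega
    · rw [YoungDiagram.mem_iff_lt_rowLen] at hm
      omega
  · intro hb hm
    have h1 := hookLength_eq μ hm
    rw [h.colLen_eq] at h1
    have := hb _ ⟨0, rfl⟩
    push_cast at h1 this
    omega

theorem bddAbove_beads (μ : YoungDiagram) : BddAbove (beads μ) := by
  refine ⟨μ.rowLen 0, ?_⟩
  rintro x ⟨i, rfl⟩
  have := μ.rowLen_anti 0 i (Nat.zero_le _)
  omega

/-- Listing the beads in decreasing order recovers the row lengths; a strictly monotone sequence is
determined by its range. -/
theorem beads_injective : Function.Injective beads := by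
  intro μ ν h
  have hmono : ∀ μ : YoungDiagram, StrictMono fun i : ℕ => (i : ℤ) + 1 - μ.rowLen i := by
    intro μ i j hij
    have := μ.rowLen_anti i j hij.le
    simp only
    omega
  have hrange : ∀ μ : YoungDiagram,
      Set.range (fun i : ℕ => (i : ℤ) + 1 - μ.rowLen i) = {x | -x ∈ beads μ} := by
    intro μ
    ext x
    simp only [Set.mem_range, beads, Set.mem_ofPred_eq]
    exact exists_congr fun i => by constructor <;> intro h <;> linarith
  have := ((hmono μ).range_inj (hmono ν)).1 (by rw [hrange, hrange, h])
  ext ⟨i, j⟩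
  have hi : (i : ℤ) + 1 - μ.rowLen i = i + 1 - ν.rowLen i := congrFun this i
  rw [YoungDiagram.mem_cells, YoungDiagram.mem_cells, YoungDiagram.mem_iff_lt_rowLen,
    YoungDiagram.mem_iff_lt_rowLen]
  omega

/-- Every bounded above, self-complementary set of integers is the set of beads of a
self-conjugate Young diagram. -/
theorem exists_beads_eq {S : Set ℤ} (hS : ∀ x, x ∈ S ↔ -1 - x ∉ S) (hb : BddAbove S) :
    ∃ μ : YoungDiagram, IsSelfConjugate μ ∧ beads μ = S := by
  obtain ⟨M, hM⟩ := hb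
  have hfin : ∀ x, {u | u ∈ S ∧ x ≤ u}.Finite := fun x =>
    (Set.finite_Icc x M).subset fun u hu => ⟨hu.2, hM hu.1⟩
  let N : ℤ → ℕ := fun x => {u | u ∈ S ∧ x ≤ u}.ncard
  have hanti : ∀ x y, x ≤ y → N y ≤ N x := fun x y h =>
    Set.ncard_le_ncard (fun u hu => ⟨hu.1, h.trans hu.2⟩) (hfin x)
  have hmem : ∀ x ∈ S, N x = N (x + 1) + 1 := by
    intro x hx
    have : {u | u ∈ S ∧ x ≤ u} = insert x {u | u ∈ S ∧ x + 1 ≤ u} := by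
      ext u
      simp only [Set.mem_ofPred_eq, Set.mem_insert_iff]
      constructor
      · rintro ⟨h1, h2⟩
        rcases h2.eq_or_lt with h | h
        · exact Or.inl h.symm
        · exact Or.inr ⟨h1, h⟩
      · rintro (rfl | ⟨h1, h2⟩)
        · exact ⟨hx, le_rfl⟩
        · exact ⟨h1, by omega⟩
    simp only [N]
    rw [this, Set.ncard_insert_of_notMem _ (hfin _)]
    simp
  have hnot : ∀ x ∉ S, N x = N (x + 1) := by
    intro x hx
    simp only [N]
    congr 1
    ext u
    simp only [Set.mem_ofPred_eq]
    constructor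
    · rintro ⟨h1, h2⟩
      rcases h2.eq_or_lt with rfl | h
      · exact absurd h1 hx
      · exact ⟨h1, h⟩
    · rintro ⟨h1, h2⟩
      exact ⟨h1, by omega⟩
  -- Exactly one of `x` and `-(x + 1)` lies in `S`, so exactly one of the two counts changes.
  have hstep : ∀ x, (N x : ℤ) - N (-x) = N (x + 1) - N (-(x + 1)) + 1 := by
    intro x
    have h2 : -x = -(x + 1) + 1 := by ring
    by_cases hx : x ∈ S
    · have h1 := hmem x hx
      have h3 := hnot (-(x + 1)) (by
        rw [show -(x + 1) = -1 - x by ring]; exact (hS x).1 hx)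
      rw [← h2] at h3
      omega
    · have h1 := hnot x hx
      have h3 := hmem (-(x + 1)) (by
        rw [show -(x + 1) = -1 - x by ring]; exact not_not.1 fun h => hx ((hS x).2 h))
      rw [← h2] at h3
      omega
  have hN : ∀ x, (N x : ℤ) = N (-x) - x := by
    intro x
    induction x using Int.induction_on with
    | zero => simp
    | succ n ih => have := hstep n; omega
    | pred n ih =>
      have := hstep (-n - 1)
      rw [sub_add_cancel] at this
      omega
  have hzero : ∀ x, M < x → N x = 0 := by
    intro x hx
    simp only [N]
    rw [Set.ncard_eq_zero (hfin x), Set.eq_empty_iff_forall_notMem]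
    rintro u ⟨h1, h2⟩
    have := hM h1
    omega
  have hsymm : ∀ i j : ℕ, i < N (j - i) ↔ j < N (i - j) := by
    intro i j
    have := hN (j - i)
    rw [neg_sub] at this
    omega
  -- Row `i` belongs to the `(i + 1)`-st largest bead and contains column `j` when that bead is at
  -- least `j - i`, that is, when more than `i` beads are.
  let cells : Set (ℕ × ℕ) := {c | c.1 < N (c.2 - c.1)}
  have hcells : cells.Finite := by
    have hbound : ∀ i j : ℕ, j ≤ i → i < N (j - i) → i < N 0 + M.toNat + 1 := by
      intro i j hji hij
      have h1 := (hsymm i j).1 hij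
      have h2 : (i : ℤ) - j ≤ M := by
        by_contra hlt
        rw [hzero _ (by omega)] at h1
        omega
      have h3 := hanti 0 (i - j) (by omega)
      omega
    let b := range (N 0 + M.toNat + 1)
    refine (b ×ˢ b).finite_toSet.subset ?_
    rintro ⟨i, j⟩ hij
    simp only [cells, Set.mem_ofPred_eq] at hij
    simp only [b, coe_product, Set.mem_prod, SetLike.mem_coe, Finset.mem_range]
    rcases le_total j i with h | h
    · have := hbound i j h hij
      omega
    · have := hbound j i h ((hsymm i j).1 hij)
      omega
  let μ : YoungDiagram := ⟨hcells.toFinset, by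
    rintro ⟨a, b⟩ ⟨c, d⟩ ⟨hca, hdb⟩ ha
    simp only [Set.Finite.coe_toFinset, cells, Set.mem_ofPred_eq] at ha ⊢ hca hdb
    have h1 : a < N (d - a) := ha.trans_le (hanti _ _ (by omega))
    exact (hsymm _ _).2 (((hsymm _ _).1 h1).trans_le (hanti _ _ (by omega)))⟩
  have hμ : ∀ i j, (i, j) ∈ μ ↔ i < N (j - i) := by
    intro i j
    rw [← YoungDiagram.mem_cells]
    simp [μ, cells]
  have hconj : IsSelfConjugate μ := by
    ext ⟨i, j⟩
    rw [YoungDiagram.mem_cells, YoungDiagram.mem_cells, YoungDiagram.mem_transpose, Prod.swap, hμ,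
      hμ]
    exact hsymm j i
  have hsub : ∀ x ∈ S, x ∈ beads μ := by
    intro x hx
    have h1 := hmem x hx
    have h2 := hN (x + 1)
    refine ⟨N (x + 1), ?_⟩
    -- The bead `x` belongs to the row numbered by the count of larger beads.
    have h3 : μ.rowLen (N (x + 1)) = (x + N (x + 1) + 1).toNat := by
      apply le_antisymm
      · by_contra hlt
        have := (hμ _ _).1 (YoungDiagram.mem_iff_lt_rowLen.2 (not_le.1 hlt))
        have h4 := hanti (x + 1) ((x + N (x + 1) + 1).toNat - N (x + 1)) (by omega)
        omega
      · by_contra hlt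
        have h5 := (hμ (N (x + 1)) (μ.rowLen (N (x + 1)))).not.1
          (by rw [YoungDiagram.mem_iff_lt_rowLen]; omega)
        have h4 := hanti (μ.rowLen (N (x + 1)) - N (x + 1)) x (by omega)
        omega
    omega
  refine ⟨μ, hconj, Set.Subset.antisymm (fun x hx => ?_) hsub⟩
  by_contra hxS
  -- One inclusion suffices, since both sets are self-complementary.
  exact (hconj.mem_beads_iff x).1 hx (hsub _ (by by_contra h; exact hxS ((hS x).2 h)))

/-! ### Self-conjugate cores and bounded sequences -/

theorem extend_fin {r : ℕ} (n : Fin r → ℤ) (i : Fin r) : extend n (i : ℕ) = n i := by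
  rw [extend, dif_pos ⟨by omega, by have := i.2; omega⟩]
  congr 1

theorem extend_of_neg {r : ℕ} (n : Fin r → ℤ) {i : ℤ} (h : i < 0) : extend n i = 0 := by
  rw [extend, dif_neg (by omega)]

theorem extend_of_le {r : ℕ} (n : Fin r → ℤ) {i : ℤ} (h : r ≤ i) : extend n i = 0 := by
  rw [extend, dif_neg (by omega)]

theorem sum_abs_extend {r : ℕ} (n : Fin r → ℤ) :
    ∑ i ∈ range (r + 1), |extend n (i : ℤ) - extend n ((i : ℤ) - 1)| =
      variation 0 (List.ofFn n) 0 := by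
  have h := variation_ofFn (fun i : ℕ => extend n ((i : ℤ) - 1)) r
  have h1 : (fun i : Fin r => extend n (((i + 1 : ℕ) : ℤ) - 1)) = n := by
    funext i
    rw [← extend_fin n i]
    congr 1; omega
  rw [h1, extend_of_neg n (by simp), extend_of_le n (by simp)] at h
  rw [h]
  refine sum_congr rfl fun i _ => ?_
  push_cast
  rw [add_sub_cancel_right]

/-- The total variation of a sequence from `0` to `0` is even, so the sign of `n_0` determines the
parity of `m` and the two cases merge into one equation. -/
theorem mem_boundedSequences_iff (t m k : ℕ) (n : Fin (t / 2) → ℤ) :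
    n ∈ boundedSequences t m k ↔
      (∀ i, -((k / 2 : ℕ) : ℤ) ≤ n i ∧ n i ≤ (((k + 1) / 2 : ℕ) : ℤ)) ∧
      (variation 0 (List.ofFn n) 0 : ℤ) = m + if 0 < extend n 0 then 1 else 0 := by
  have hp := variation_parity 0 (List.ofFn n) 0
  simp only [boundedSequences, Set.mem_ofPred_eq, sum_abs_extend]
  constructor
  · rintro ⟨h1, h2, h3, h4⟩
    refine ⟨h3, ?_⟩
    rcases Nat.even_or_odd m with hm | hm
    · rw [if_neg (Nat.not_odd_iff_even.2 hm)] at h4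
      rw [if_neg (not_lt.2 (h2 hm)), h4, add_zero]
    · rw [if_pos hm] at h4
      rw [if_pos (h1 hm), h4]
  · rintro ⟨h1, h2⟩
    split_ifs at h2 with h0
    · have hm : Odd m := by rw [Nat.odd_iff]; omega
      exact ⟨fun _ => h0, fun h => absurd hm (Nat.not_odd_iff_even.2 h), h1, by rw [if_pos hm, h2]⟩
    · have hm : ¬ Odd m := by rw [Nat.odd_iff]; omega
      exact ⟨fun h => absurd h hm, fun _ => not_lt.1 h0, h1, by rw [if_neg hm, h2, add_zero]⟩

/-- The number of beads with non-negative quotient (counted with sign) on each runner of the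
`t`-abacus. -/
def runner (t : ℕ) (n : Fin (t / 2) → ℤ) (i : ℤ) : ℤ := extend n i - extend n (t - 1 - i)

/-- The bead configuration of a symmetric `t`-core with given runners. -/
def runnerBeads (t : ℕ) (n : Fin (t / 2) → ℤ) : Set ℤ := {x | x / t < runner t n (x % t)}

theorem runner_symm (t : ℕ) (n : Fin (t / 2) → ℤ) (i : ℤ) :
    runner t n (t - 1 - i) = -runner t n i := by
  rw [runner, runner, sub_sub_cancel, neg_sub]

theorem runner_of_lt {t : ℕ} (n : Fin (t / 2) → ℤ) {i : ℤ} (h : i + (t / 2 : ℕ) + 1 ≤ t) :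
    runner t n i = extend n i := by
  rw [runner, extend_of_le n (i := t - 1 - i) (by omega), sub_zero]

theorem mem_runnerBeads {t : ℕ} (n : Fin (t / 2) → ℤ) {i : ℤ} (h0 : 0 ≤ i) (ht : i < t) (j : ℤ) :
    i + t * j ∈ runnerBeads t n ↔ j < runner t n i := by
  rw [runnerBeads, Set.mem_ofPred_eq, Int.add_mul_ediv_left _ _ (by omega), Int.add_mul_emod_self_left,
    Int.ediv_eq_zero_of_lt h0 ht, Int.emod_eq_of_lt h0 ht, zero_add]

theorem exists_eq_add_mul {t : ℕ} (ht : 1 ≤ t) (x : ℤ) :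
    ∃ i j : ℤ, 0 ≤ i ∧ i < t ∧ x = i + t * j :=
  ⟨x % t, x / t, Int.emod_nonneg _ (by omega), Int.emod_lt_of_pos _ (by omega),
    (Int.emod_add_mul_ediv x t).symm⟩

theorem mem_runnerBeads_symm {t : ℕ} (ht : 1 ≤ t) (n : Fin (t / 2) → ℤ) (x : ℤ) :
    x ∈ runnerBeads t n ↔ -1 - x ∉ runnerBeads t n := by
  obtain ⟨i, j, h0, h1, rfl⟩ := exists_eq_add_mul ht x
  rw [show -1 - (i + t * j) = (t - 1 - i) + t * (-1 - j) by ring, mem_runnerBeads n h0 h1,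
    mem_runnerBeads n (by omega) (by omega), runner_symm]
  omega

theorem bddAbove_runnerBeads {t : ℕ} (ht : 1 ≤ t) (n : Fin (t / 2) → ℤ) :
    BddAbove (runnerBeads t n) := by
  refine ⟨t + t * ∑ i ∈ range t, |runner t n i|, fun x hx => ?_⟩
  obtain ⟨i, j, h0, h1, rfl⟩ := exists_eq_add_mul ht x
  rw [mem_runnerBeads n h0 h1] at hx
  lift i to ℕ using h0
  have h2 : |runner t n i| ≤ ∑ i ∈ range t, |runner t n i| :=
    single_le_sum (f := fun i : ℕ => |runner t n i|) (fun _ _ => abs_nonneg _)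
      (Finset.mem_range.2 (by omega))
  have h3 : (t : ℤ) * j ≤ t * ∑ i ∈ range t, |runner t n i| :=
    mul_le_mul_of_nonneg_left ((hx.le.trans (le_abs_self _)).trans h2) (by omega)
  omega

theorem runnerBeads_injective (t : ℕ) : Function.Injective (runnerBeads t) := by
  intro n n' h
  funext i
  have hi := i.2
  have key : ∀ n : Fin (t / 2) → ℤ, ∀ j, ((i : ℕ) : ℤ) + t * j ∈ runnerBeads t n ↔ j < n i := by
    intro n j
    rw [mem_runnerBeads n (by omega) (by omega), runner_of_lt n (by omega), extend_fin]
  have h1 := key n (n' i)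
  have h2 := key n' (n i)
  rw [h, key n'] at h1
  rw [← h, key n] at h2
  omega

theorem sub_mem_runnerBeads {t : ℕ} (ht : 1 ≤ t) (n : Fin (t / 2) → ℤ) {x : ℤ}
    (hx : x ∈ runnerBeads t n) : x - t ∈ runnerBeads t n := by
  obtain ⟨i, j, h0, h1, rfl⟩ := exists_eq_add_mul ht x
  rw [mem_runnerBeads n h0 h1] at hx
  rw [show i + t * j - t = i + t * (j - 1) by ring, mem_runnerBeads n h0 h1]
  omega

/-- Closure under subtraction of `t` makes each residue class an initial segment, whose end is the
required entry. -/
theorem exists_runnerBeads_eq {t : ℕ} (ht : 1 ≤ t) {S : Set ℤ} (hS : ∀ x, x ∈ S ↔ -1 - x ∉ S)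
    (hb : BddAbove S) (hcore : ∀ x ∈ S, x - t ∈ S) : ∃ n, runnerBeads t n = S := by
  obtain ⟨M, hM⟩ := hb
  have ht' : (1 : ℤ) ≤ t := by exact_mod_cast ht
  have hdown : ∀ (i j : ℤ) (d : ℕ), i + t * j ∈ S → i + t * (j - d) ∈ S := by
    intro i j d h
    induction d with
    | zero => simpa using h
    | succ d ih =>
      convert hcore _ ih using 1
      push_cast; ring
  have hd : ∀ i : ℤ, ∃ d : ℤ, ∀ j, i + t * j ∈ S ↔ j < d := by
    intro i
    obtain ⟨d, hd, hmax⟩ := Int.exists_greatest_of_bdd (P := fun j => i + t * j ∈ S)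
      ⟨|M| + |i|, fun j hj => by
        have := hM hj
        have h1 := le_abs_self M
        have h2 := neg_abs_le i
        have h3 := abs_nonneg M
        have h4 := abs_nonneg i
        by_contra hlt
        nlinarith⟩
      -- With this quotient the mirror image `-1 - x` exceeds `M`, so `x` is in `S`.
      ⟨-(|M| + |i| + 2), by
        rw [hS]
        intro h
        have := hM h
        have h1 := le_abs_self M
        have h2 := le_abs_self i
        have h3 := abs_nonneg M
        have h4 := abs_nonneg i
        nlinarith⟩
    refine ⟨d + 1, fun j => ⟨fun h => by have := hmax j h; omega, fun h => ?_⟩⟩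
    have := hdown i d (d - j).toNat hd
    rwa [show d - ((d - j).toNat : ℤ) = j by omega] at this
  choose d hd using hd
  have hsymm : ∀ i, d (t - 1 - i) = -d i := by
    intro i
    have key : ∀ j, j < d i ↔ ¬ -1 - j < d (t - 1 - i) := by
      intro j
      rw [← hd, ← hd, hS]
      ring_nf
    have h1 := key (d i)
    have h2 := key (d i - 1)
    omega
  refine ⟨fun i => d i, ?_⟩
  ext x
  obtain ⟨i, j, h0, h1, rfl⟩ := exists_eq_add_mul ht x
  rw [mem_runnerBeads _ h0 h1, hd]
  have hext : ∀ i : ℤ, 0 ≤ i → i < (t / 2 : ℕ) →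
      extend (fun i : Fin (t / 2) => d (i : ℕ)) i = d i := by
    intro i h0 h1
    rw [extend, dif_pos ⟨h0, h1⟩]
    simp only
    congr 1; omega
  have : runner t (fun i : Fin (t / 2) => d (i : ℕ)) i = d i := by
    have hs := hsymm i
    rw [runner]
    by_cases h2 : i < (t / 2 : ℕ)
    · rw [hext i h0 h2, extend_of_le _ (by omega), sub_zero]
    · rw [extend_of_le _ (by omega)]
      by_cases h3 : (t : ℤ) - 1 - i < (t / 2 : ℕ)
      · rw [hext _ (by omega) h3]; omega
      · rw [extend_of_le _ (by omega)]
        -- The middle runner for odd `t` is its own mirror image, so its end is zero.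
        rw [show (t : ℤ) - 1 - i = i by omega] at hs
        omega
  rw [this]

/-- The last beads of runners `i` and `t - 1 - i` give the upper and the lower bound on `n_i`. The
bounds differ in rounding because `2 * i + 1 < t` puts `i` in the lower half of the runners. -/
theorem runnerBeads_lt_iff {t : ℕ} (ht : 1 ≤ t) (k : ℕ) (n : Fin (t / 2) → ℤ) :
    (∀ x ∈ runnerBeads t n, 2 * x + 1 < ((k * t : ℕ) : ℤ)) ↔
      ∀ i, -((k / 2 : ℕ) : ℤ) ≤ n i ∧ n i ≤ (((k + 1) / 2 : ℕ) : ℤ) := by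
  push_cast
  constructor
  · intro h i
    have hi := i.2
    have h1 := h ((i : ℕ) + t * (n i - 1)) ((mem_runnerBeads n (by omega) (by omega) _).2 (by
      rw [runner_of_lt n (by omega), extend_fin]; omega))
    have h2 := h ((t - 1 - (i : ℕ)) + t * (-n i - 1))
      ((mem_runnerBeads n (by omega) (by omega) _).2 (by
        rw [runner_symm, runner_of_lt n (by omega), extend_fin]; omega))
    have h3 : 2 * n i - 2 < k := by
      by_contra hlt
      nlinarith
    have h4 : -2 * n i - 1 < k := by
      by_contra hlt
      have : (t : ℤ) * k ≤ t * (-2 * n i - 1) := mul_le_mul_of_nonneg_left (by omega) (by omega)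
      have : 2 * ((i : ℕ) : ℤ) + 1 < t := by omega
      nlinarith
    omega
  · intro h x hx
    obtain ⟨i, j, h0, h1, rfl⟩ := exists_eq_add_mul ht x
    rw [mem_runnerBeads n h0 h1] at hx
    have hext : ∀ i, -((k / 2 : ℕ) : ℤ) ≤ extend n i ∧ extend n i ≤ (((k + 1) / 2 : ℕ) : ℤ) := by
      intro i
      rw [extend]
      split_ifs
      · exact h _
      · omega
    by_cases h2 : i < (t / 2 : ℕ)
    · rw [runner_of_lt n (by omega)] at hx
      have := hext i
      have : (t : ℤ) * (2 * j) ≤ t * (k - 1) := mul_le_mul_of_nonneg_left (by omega) (by omega)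
      have : 2 * i + 1 < t := by omega
      nlinarith
    · rw [runner, extend_of_le n (by omega)] at hx
      by_cases h3 : (t : ℤ) - 1 - i < (t / 2 : ℕ)
      · have := hext (t - 1 - i)
        have : (t : ℤ) * (2 * j) ≤ t * (k - 2) := mul_le_mul_of_nonneg_left (by omega) (by omega)
        nlinarith
      · rw [extend_of_le n (by omega)] at hx
        have : (t : ℤ) * (2 * j) ≤ t * (-2) := mul_le_mul_of_nonneg_left (by omega) (by omega)
        have : (0 : ℤ) ≤ k * t := by positivity
        nlinarith

/-- The predecessor of a position lies on the previous runner with the same quotient, except that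
runner `0` is preceded by runner `t - 1` with quotient one less; hence the `+ 1`. -/
theorem ncard_runnerBeads {t : ℕ} (ht : 1 ≤ t) (n : Fin (t / 2) → ℤ) :
    {x | x ∈ runnerBeads t n ∧ x - 1 ∉ runnerBeads t n}.ncard =
      ∑ i ∈ range t, (runner t n i -
        if i = 0 then runner t n (t - 1) + 1 else runner t n (i - 1)).toNat := by
  have hmem : ∀ (i : ℕ) (j : ℤ), i < t → (((i : ℤ) + t * j ∈ runnerBeads t n ∧
      (i : ℤ) + t * j - 1 ∉ runnerBeads t n) ↔
      j ∈ Ico (if i = 0 then runner t n (t - 1) + 1 else runner t n (i - 1)) (runner t n i)) := by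
    intro i j hi
    rw [mem_runnerBeads n (by omega) (by omega), Finset.mem_Ico, and_comm]
    refine and_congr_left fun _ => ?_
    split_ifs with h
    · rw [h, show ((0 : ℕ) : ℤ) + t * j - 1 = (t - 1) + t * (j - 1) by push_cast; ring,
        mem_runnerBeads n (by omega) (by omega)]
      omega
    · rw [show (i : ℤ) + t * j - 1 = (i - 1) + t * j by ring,
        mem_runnerBeads n (by omega) (by omega)]
      omega
  have : {x | x ∈ runnerBeads t n ∧ x - 1 ∉ runnerBeads t n} =
      (((range t).sigma fun i =>
        Ico (if i = 0 then runner t n (t - 1) + 1 else runner t n (i - 1)) (runner t n i)).image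
          fun p => (p.1 : ℤ) + t * p.2 : Finset ℤ) := by
    ext x
    simp only [Set.mem_ofPred_eq, coe_image, Set.mem_image, SetLike.mem_coe, mem_sigma,
      Finset.mem_range, Sigma.exists]
    constructor
    · intro hx
      obtain ⟨i, j, h0, h1, rfl⟩ := exists_eq_add_mul ht x
      lift i to ℕ using h0
      exact ⟨i, j, ⟨by omega, (hmem i j (by omega)).1 hx⟩, rfl⟩
    · rintro ⟨i, j, ⟨hi, hj⟩, rfl⟩
      exact (hmem i j hi).2 hj
  rw [this, Set.ncard_coe_finset, card_image_of_injOn, card_sigma]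
  · simp only [Int.card_Ico]
  · rintro ⟨i, j⟩ hp ⟨i', j'⟩ hp' h
    simp only [SetLike.mem_coe, mem_sigma, Finset.mem_range] at hp hp' h
    have h1 : (i : ℤ) = i' := by
      have := congrArg (· % (t : ℤ)) h
      simpa only [Int.add_mul_emod_self_left, Int.emod_eq_of_lt (Int.natCast_nonneg i) (by omega : (i : ℤ) < t),
        Int.emod_eq_of_lt (Int.natCast_nonneg i') (by omega : (i' : ℤ) < t)] using this
    have h2 : j = j' := by
      rw [h1, add_right_inj] at h
      exact mul_left_cancel₀ (by omega) h
    obtain rfl : i = i' := by exact_mod_cast h1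
    rw [h2]

/-- Antisymmetry of the runners makes their differences a palindrome. For even `t` the central
difference runs from `n_q` to `-n_q`, twice the final difference from `n_q` to `0`. -/
theorem sum_palindrome {t : ℕ} (f g : ℕ → ℕ) (ht : 1 ≤ t)
    (hf : ∀ i, i + 2 + t / 2 ≤ t → f i = g i) (hsymm : ∀ i j, i + j + 2 = t → f i = f j)
    (hmid : ∀ q, t = 2 * (q + 1) → f q = 2 * g q) :
    ∑ i ∈ range (t - 1), f i = 2 * ∑ i ∈ range (t / 2), g i := by
  rcases Nat.even_or_odd' t with ⟨r, hr | hr⟩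
  · obtain ⟨q, rfl⟩ : ∃ q, r = q + 1 := ⟨r - 1, by omega⟩
    have h1 : ∑ i ∈ range q, f i = ∑ i ∈ range q, g i :=
      sum_congr rfl fun i hi => hf i (by rw [Finset.mem_range] at hi; omega)
    have h2 : ∑ i ∈ range q, f (q + 1 + i) = ∑ i ∈ range q, g i := by
      rw [← h1, ← sum_range_reflect]
      exact sum_congr rfl fun i hi => hsymm _ _ (by rw [Finset.mem_range] at hi; omega)
    rw [show t - 1 = q + 1 + q by omega, show t / 2 = q + 1 by omega, sum_range_add,
      sum_range_succ, sum_range_succ, h1, h2, hmid q hr]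
    ring
  · have h1 : ∑ i ∈ range r, f i = ∑ i ∈ range r, g i :=
      sum_congr rfl fun i hi => hf i (by rw [Finset.mem_range] at hi; omega)
    have h2 : ∑ i ∈ range r, f (r + i) = ∑ i ∈ range r, g i := by
      rw [← h1, ← sum_range_reflect]
      exact sum_congr rfl fun i hi => hsymm _ _ (by rw [Finset.mem_range] at hi; omega)
    rw [show t - 1 = r + r by omega, show t / 2 = r by omega, sum_range_add, h1, h2]
    ring

theorem sum_toNat_runner {t : ℕ} (ht : 1 ≤ t) (n : Fin (t / 2) → ℤ) :
    ∑ i ∈ range (t - 1), (runner t n (i + 1) - runner t n i).toNat =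
      2 * ∑ i ∈ range (t / 2), (extend n (i + 1) - extend n i).toNat := by
  have hf : ∀ i : ℕ, i + 2 + t / 2 ≤ t → (runner t n (i + 1) - runner t n i).toNat =
      (extend n (i + 1) - extend n i).toNat := by
    intro i hi
    rw [runner_of_lt n (by omega), runner_of_lt n (by omega)]
  have hsymm : ∀ i j : ℕ, i + j + 2 = t → (runner t n (i + 1) - runner t n i).toNat =
      (runner t n (j + 1) - runner t n j).toNat := by
    intro i j hij
    rw [show (j : ℤ) + 1 = t - 1 - i by omega, show (j : ℤ) = t - 1 - (i + 1) by omega, runner_symm,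
      runner_symm]
    congr 1; ring
  refine sum_palindrome _ _ ht hf hsymm fun q hq => ?_
  rw [show (q : ℤ) + 1 = t - 1 - q by omega, runner_symm, runner_of_lt n (by omega),
    extend_of_le n (i := t - 1 - q) (by omega)]
  omega

/-- Since `|δ| = 2δ⁺ - δ` and the differences from `n_0` to the final `0` sum to `-n_0`, the
variation is `|n_0| + n_0` plus twice the positive parts. The wrap-around contributes `(2 * n_0 -
1)⁺` corners, which is `|n_0| + n_0 - [n_0 > 0]`. -/
theorem ncard_add_eq_variation {t : ℕ} (ht : 1 ≤ t) (n : Fin (t / 2) → ℤ) :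
    ({x | x ∈ runnerBeads t n ∧ x - 1 ∉ runnerBeads t n}.ncard : ℤ) +
      (if 0 < extend n 0 then 1 else 0) = variation 0 (List.ofFn n) 0 := by
  have h1 : ({x | x ∈ runnerBeads t n ∧ x - 1 ∉ runnerBeads t n}.ncard) =
      (2 * extend n 0 - 1).toNat +
        2 * ∑ i ∈ range (t / 2), (extend n (i + 1) - extend n i).toNat := by
    have hsucc : ∀ F : ℕ → ℕ, ∑ i ∈ range t, F i = ∑ i ∈ range (t - 1), F (i + 1) + F 0 := by
      intro F
      rw [← sum_range_succ', Nat.sub_add_cancel ht]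
    rw [ncard_runnerBeads ht, ← sum_toNat_runner ht, hsucc, add_comm]
    congr 1
    · have h0 := runner_symm t n 0
      rw [sub_zero, runner_of_lt n (i := 0) (by omega)] at h0
      rw [if_pos rfl, h0, Nat.cast_zero, runner_of_lt n (i := 0) (by omega)]
      congr 1; ring
    · refine sum_congr rfl fun i _ => ?_
      rw [if_neg (Nat.succ_ne_zero i)]
      push_cast
      rw [add_sub_cancel_right]
  have h2 : (variation 0 (List.ofFn n) 0 : ℤ) = |extend n 0| + extend n 0 +
      2 * ∑ i ∈ range (t / 2), ((extend n (i + 1) - extend n i).toNat : ℤ) := by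
    rw [← sum_abs_extend, sum_range_succ', Nat.cast_zero, zero_sub,
      extend_of_neg n (i := -1) (by norm_num), sub_zero]
    have h3 := sum_range_sub (fun i : ℕ => extend n i) (t / 2)
    rw [extend_of_le n le_rfl] at h3
    have h4 : ∀ i : ℕ, |extend n ((i + 1 : ℕ) : ℤ) - extend n (((i + 1 : ℕ) : ℤ) - 1)| =
        2 * ((extend n (i + 1) - extend n i).toNat : ℤ) -
          (extend n ((i + 1 : ℕ) : ℤ) - extend n i) := by
      intro i
      push_cast
      rw [add_sub_cancel_right]
      rcases le_total 0 (extend n ((i : ℤ) + 1) - extend n i) with h | h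
      · rw [abs_of_nonneg h]; omega
      · rw [abs_of_nonpos h]; omega
    simp only [h4, sum_sub_distrib (s := range (t / 2)) (f := fun i : ℕ =>
      2 * ((extend n (i + 1) - extend n i).toNat : ℤ)), ← mul_sum]
    rw [h3]
    push_cast
    ring
  rw [h1, h2]
  push_cast
  split_ifs with h
  · rw [abs_of_pos h]; omega
  · rw [abs_of_nonpos (not_lt.1 h)]; omega

theorem nonempty_cores_equiv_sequences {t : ℕ} (ht : 1 ≤ t) (m k : ℕ) :
    Nonempty (selfConjugateCores t m k ≃ boundedSequences t m k) := by
  have hex : ∀ n : Fin (t / 2) → ℤ, ∃ μ, IsSelfConjugate μ ∧ beads μ = runnerBeads t n := fun n =>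
    exists_beads_eq (mem_runnerBeads_symm ht n) (bddAbove_runnerBeads ht n)
  choose f hf1 hf2 using hex
  have hmem : ∀ n, f n ∈ selfConjugateCores t m k ↔ n ∈ boundedSequences t m k := by
    intro n
    have h1 := ncard_add_eq_variation ht n
    have h2 : IsCore t (f n) := by
      rw [isCore_iff _ ht, hf2]
      exact fun x hx => sub_mem_runnerBeads ht n hx
    rw [mem_boundedSequences_iff, selfConjugateCores, Set.mem_ofPred_eq,
      (hf1 n).hookLength_lt_iff, ncard_innerCorners, hf2, runnerBeads_lt_iff ht]
    simp only [hf1 n, h2, true_and]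
    rw [and_comm]
    refine and_congr_right fun _ => ?_
    rw [← h1, add_left_inj, Nat.cast_inj]
  refine ⟨(Set.BijOn.equiv f (s := boundedSequences t m k) ⟨fun n hn => (hmem n).2 hn, ?_, ?_⟩).symm⟩
  · intro n _ n' _ h
    exact runnerBeads_injective t (by rw [← hf2, ← hf2, h])
  · intro μ hμ
    have hμ' := hμ
    obtain ⟨h1, h2, -⟩ := hμ
    obtain ⟨n, hn⟩ := exists_runnerBeads_eq ht h1.mem_beads_iff (bddAbove_beads μ)
      ((isCore_iff μ ht).1 h2)
    have : f n = μ := beads_injective (by rw [hf2, hn])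
    exact ⟨n, (hmem n).1 (this ▸ hμ'), this⟩

/-! ### Degenerate cases with `t < 2` -/

theorem nonempty_equiv_of_subsingleton {α β : Type*} {A : Set α} {B : Set β}
    (hA : A.Subsingleton) (hB : B.Subsingleton) (h : A.Nonempty ↔ B.Nonempty) :
    Nonempty (A ≃ B) := by
  have := hA.coe_sort
  have := hB.coe_sort
  rcases A.eq_empty_or_nonempty with rfl | hne
  · obtain rfl := Set.not_nonempty_iff_eq_empty.1 (h.not.1 Set.not_nonempty_empty)
    exact ⟨Equiv.equivOfIsEmpty _ _⟩
  · have : Unique A := uniqueOfSubsingleton ⟨_, hne.some_mem⟩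
    have : Unique B := uniqueOfSubsingleton ⟨_, (h.1 hne).some_mem⟩
    exact ⟨Equiv.ofUnique _ _⟩

theorem boundedSequences_of_lt_two {t : ℕ} (ht : t < 2) (m k : ℕ) :
    (boundedSequences t m k).Subsingleton ∧ ((boundedSequences t m k).Nonempty ↔ m = 0) := by
  have hiff : ∀ n, n ∈ boundedSequences t m k ↔ m = 0 := by
    intro n
    have h0 : extend n 0 = 0 := extend_of_le n (by omega)
    have h1 : List.ofFn n = [] := List.length_eq_zero_iff.1 (by rw [List.length_ofFn]; omega)
    rw [mem_boundedSequences_iff, h0, h1]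
    refine ⟨fun h => by simpa [variation, eq_comm] using h.2, fun h => ⟨fun i => ?_, ?_⟩⟩
    · have := i.2; omega
    · simp [variation, h]
  exact ⟨fun n _ n' _ => funext fun i => by have := i.2; omega,
    ⟨fun ⟨n, hn⟩ => (hiff n).1 hn, fun h => ⟨fun _ => 0, (hiff _).2 h⟩⟩⟩

/-- For `t = 0` the hook bound is `0`, which leaves only the empty partition. -/
theorem nonempty_cores_zero_equiv (m k : ℕ) :
    Nonempty (selfConjugateCores 0 m k ≃ boundedSequences 0 m k) := by
  have hbot : ∀ μ ∈ selfConjugateCores 0 m k, μ = ⊥ := by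
    rintro μ ⟨-, -, -, h⟩
    ext ⟨i, j⟩
    rw [YoungDiagram.mem_cells, YoungDiagram.mem_cells]
    refine ⟨fun hm => ?_, fun hm => absurd hm (YoungDiagram.notMem_bot _)⟩
    simpa using h (μ.up_left_mem (Nat.zero_le i) (Nat.zero_le j) hm)
  have hiff : ⊥ ∈ selfConjugateCores 0 m k ↔ m = 0 := by
    have : innerCorners ⊥ = ∅ := by
      ext c; simp [innerCorners]
    have ht : (⊥ : YoungDiagram).transpose = ⊥ := by ext; simp
    simp [selfConjugateCores, this, IsSelfConjugate, IsCore, ht, eq_comm (a := m)]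
  obtain ⟨h1, h2⟩ := boundedSequences_of_lt_two (t := 0) (by omega) m k
  refine nonempty_equiv_of_subsingleton (fun μ hμ ν hν => (hbot μ hμ).trans (hbot ν hν).symm) h1 ?_
  rw [h2, ← hiff]
  exact ⟨fun ⟨μ, hμ⟩ => hbot μ hμ ▸ hμ, fun h => ⟨_, h⟩⟩

/-! ### Bijections with sets of paths -/

theorem forall_mem_ofFn {r : ℕ} (n : Fin r → ℤ) (p : ℤ → Prop) :
    (∀ h ∈ List.ofFn n, p h) ↔ ∀ i, p (n i) := by
  simp [List.mem_ofFn]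

theorem headD_ofFn {r : ℕ} (n : Fin r → ℤ) : (List.ofFn n).headD 0 = extend n 0 := by
  cases r with
  | zero => rw [extend_of_le n (by simp)]; rfl
  | succ r => rw [List.ofFn_succ, List.headD_cons]; exact (extend_fin n 0).symm

theorem ofFn_getD {l : List ℤ} {r : ℕ} (h : l.length = r) :
    (List.ofFn fun i : Fin r => l.getD i 0) = l := by
  subst h
  conv_rhs => rw [← List.ofFn_get l]
  congr 1
  funext i
  simp

theorem nonempty_sequences_equiv_freePaths (t m k : ℕ) :
    Nonempty (boundedSequences t m k ≃ cornerlessFreePaths m (t / 2) k) := by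
  -- A path ending at `0` has a number of non-flat steps congruent to its start mod 2, so the start
  -- is forced to be `m % 2`.
  let f : (Fin (t / 2) → ℤ) → LatticePath := fun n =>
    ⟨(m % 2 : ℕ), pathThrough (m % 2 : ℕ) (List.ofFn n) 0⟩
  have hmem : ∀ n, f n ∈ cornerlessFreePaths m (t / 2) k ↔ n ∈ boundedSequences t m k := by
    intro n
    have hend := height_length (m % 2 : ℕ) (pathThrough (m % 2 : ℕ) (List.ofFn n) 0)
    rw [length_pathThrough, rise_pathThrough, List.length_ofFn] at hend
    have hvlt := variation_of_lt (s := 0) (l := List.ofFn n) (e := 0)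
    -- For odd `m` the start `1` must lie in the strip, which requires `1 ≤ k`.
    have hbound : 0 < extend n 0 →
        (∀ i, -((k / 2 : ℕ) : ℤ) ≤ n i ∧ n i ≤ (((k + 1) / 2 : ℕ) : ℤ)) → 1 ≤ k := by
      intro h hb
      rw [extend] at h
      split_ifs at h with h'
      · have := hb ⟨(0 : ℤ).toNat, by omega⟩
        omega
      · omega
    have hp := variation_parity 0 (List.ofFn n) 0
    rw [mem_cornerlessFreePaths, mem_boundedSequences_iff]
    simp only [f, freePaths, Set.mem_ofPred_eq, LatticePath.IsFreeMotzkin, hend,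
      inStrip_pathThrough, forall_mem_ofFn n fun h => -((k / 2 : ℕ) : ℤ) ≤ h ∧
      h ≤ (((k + 1) / 2 : ℕ) : ℤ), LatticePath.length, length_pathThrough, LatticePath.flats,
      count_flat_eq_length_flatHeights ((m % 2 : ℕ) : ℤ), flatHeights_pathThrough, List.length_ofFn,
      cornerless_iff_isChain, isChain_pathThrough, ne_eq, head?_pathThrough_eq_up,
      head?_pathThrough_eq_down, headD_ofFn, true_and] at hvlt ⊢
    rcases Nat.even_or_odd' m with ⟨q, hq | hq⟩
    · have h1 : m % 2 = 0 := by omega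
      have h2 : Even m := ⟨q, by omega⟩
      simp only [h1, h2, Nat.not_odd_iff_even.2 h2, Nat.cast_zero, forall_const, false_imp_iff,
        true_and]
      constructor
      · rintro ⟨⟨-, h3, -, -, h4⟩, h5⟩
        refine ⟨h4, ?_⟩
        rw [if_neg h5]; omega
      · rintro ⟨h3, h4⟩
        have h5 : ¬ 0 < extend n 0 := fun h => by
          rw [if_pos h] at h4; omega
        rw [if_neg h5] at h4
        exact ⟨⟨by simp, by omega, by omega, by omega, h3⟩, h5⟩
    · have h1 : m % 2 = 1 := by omega
      have h2 : Odd m := ⟨q, hq⟩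
      simp only [h1, h2, Nat.not_even_iff_odd.2 h2, Nat.cast_one, forall_const, false_imp_iff,
        and_true]
      constructor
      · rintro ⟨⟨-, h3, -, -, h4⟩, h5⟩
        have h6 := hvlt (by omega)
        refine ⟨h4, ?_⟩
        rw [if_pos (by omega), h6]
        rw [zero_add]
        omega
      · rintro ⟨h3, h4⟩
        have h5 : 0 < extend n 0 := by
          by_contra h
          rw [if_neg h] at h4; omega
        have h6 := hvlt h5
        have h7 := hbound h5 h3
        rw [if_pos h5, h6, zero_add] at h4
        exact ⟨⟨by simp, by omega, by omega, by omega, h3⟩, by omega⟩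
  refine ⟨Set.BijOn.equiv f ⟨fun n hn => (hmem n).2 hn, ?_, ?_⟩⟩
  · intro n _ n' _ h
    have := congrArg (fun P : LatticePath => flatHeights P.start P.steps) h
    simp only [f, flatHeights_pathThrough] at this
    exact List.ofFn_injective this
  · rintro ⟨s, w⟩ hP
    have hP' := (mem_cornerlessFreePaths _ _ _ _).1 hP
    simp only [freePaths, Set.mem_ofPred_eq, LatticePath.IsFreeMotzkin, height_length,
      LatticePath.length, LatticePath.flats, count_flat_eq_length_flatHeights s,
      cornerless_iff_isChain] at hP'
    obtain ⟨⟨⟨h1, h2⟩, h3, h4, -⟩, h5, -⟩ := hP'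
    have hw := pathThrough_flatHeights h5 s
    rw [h2] at hw
    have hlen := length_pathThrough s (flatHeights s w) 0
    have hp := variation_parity s (flatHeights s w) 0
    rw [hw, h3, h4] at hlen
    have hs : s = (m % 2 : ℕ) := by omega
    have hf : f (fun i => (flatHeights s w).getD i 0) = ⟨s, w⟩ := by
      simp only [f, ofFn_getD h4, ← hs, hw]
    exact ⟨_, (hmem _).1 (hf ▸ hP), hf⟩

/-- The sequences for `t / 2 = r + 1` correspond to the pairs of a first entry and a list of
further entries. -/
theorem nonempty_middlePairs_equiv_sequences {t r : ℕ} (hr : t / 2 = r + 1) (m k : ℕ) :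
    Nonempty (middlePairs k r m ≃ boundedSequences t m k) := by
  let g : ℕ × List ℤ → List ℤ := fun p => (-((k / 2 : ℕ) : ℤ) + p.1) :: p.2
  let f : ℕ × List ℤ → Fin (t / 2) → ℤ := fun p i => (g p).getD i 0
  have hf : ∀ p, p.2.length = r → List.ofFn (f p) = g p := fun p hp =>
    ofFn_getD (by simp [g, hp, hr])
  have hmem : ∀ p : ℕ × List ℤ, p.2.length = r →
      (f p ∈ boundedSequences t m k ↔ p ∈ middlePairs k r m) := by
    intro p hp
    have h0 : extend (f p) 0 = -((k / 2 : ℕ) : ℤ) + p.1 := by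
      rw [← headD_ofFn, hf p hp]; rfl
    rw [mem_boundedSequences_iff, ← forall_mem_ofFn (f p) fun h => -((k / 2 : ℕ) : ℤ) ≤ h ∧
      h ≤ (((k + 1) / 2 : ℕ) : ℤ), h0, hf p hp, middlePairs, mem_filter, mem_product,
      mem_boundedLists]
    have hk : (((k + 1) / 2 : ℕ) : ℤ) = -((k / 2 : ℕ) : ℤ) + k := by omega
    simp only [g, List.forall_mem_cons, variation, Finset.mem_range, hp, true_and, hk]
    have h1 : (-((k / 2 : ℕ) : ℤ) ≤ -((k / 2 : ℕ) : ℤ) + p.1 ∧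
        -((k / 2 : ℕ) : ℤ) + p.1 ≤ -((k / 2 : ℕ) : ℤ) + k) ↔ p.1 < k + 1 := by omega
    rw [h1]
    refine and_congr_right fun _ => ?_
    -- With `n_0 = p.1 - k / 2`, the exponent in `middlePairs` is `|n_0| - [n_0 > 0]`.
    split_ifs <;> omega
  refine ⟨Set.BijOn.equiv f (s := middlePairs k r m) ⟨?_, ?_, ?_⟩⟩
  · intro p hp
    refine (hmem p ?_).2 hp
    simp only [middlePairs, SetLike.mem_coe, mem_filter, mem_product, mem_boundedLists] at hp
    exact hp.1.2.1
  · intro p hp p' hp' h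
    simp only [middlePairs, SetLike.mem_coe, mem_filter, mem_product, mem_boundedLists] at hp hp'
    have := hf p hp.1.2.1
    rw [h, hf p' hp'.1.2.1] at this
    simp only [g, List.cons.injEq, add_right_inj, Nat.cast_inj] at this
    exact Prod.ext this.1.symm this.2.symm
  · intro n hn
    have hlen : (List.ofFn n).length = r + 1 := by rw [List.length_ofFn, hr]
    obtain ⟨x, l, hxl⟩ := List.exists_cons_of_length_eq_add_one hlen
    have hb := ((mem_boundedSequences_iff _ _ _ _).1 hn).1
    rw [← forall_mem_ofFn n fun h => -((k / 2 : ℕ) : ℤ) ≤ h ∧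
      h ≤ (((k + 1) / 2 : ℕ) : ℤ), hxl, List.forall_mem_cons] at hb
    have hl : l.length = r := by simpa [hxl] using hlen
    have hfn : f ((x + (k / 2 : ℕ)).toNat, l) = n := by
      apply List.ofFn_injective
      rw [hf _ hl, hxl]
      simp only [g]
      congr 1; omega
    exact ⟨_, (hmem _ hl).1 (hfn ▸ hn), hfn⟩

/-- The cornerless step sequences of length `m + r` with `r` flat steps that start at height `0`
and stay in the strip `0 ≤ y ≤ k`. -/
def cornerlessSteps (m r k : ℕ) : Set (List Step) :=
  {u | u.IsChain Step.Smooth ∧ u.length = m + r ∧ u.count .flat = r ∧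
    LatticePath.InStrip ⟨0, u⟩ 0 k}

theorem nonempty_boundaryPairs_equiv_steps (m r k : ℕ) :
    Nonempty (boundaryPairs k r m ≃ cornerlessSteps m r k) := by
  let f : ℕ × List ℤ → List Step := fun p => pathThrough 0 p.2 p.1
  have hmem : ∀ p : ℕ × List ℤ, f p ∈ cornerlessSteps m r k ↔ p ∈ boundaryPairs k r m := by
    intro p
    simp only [f, cornerlessSteps, Set.mem_ofPred_eq, isChain_pathThrough, length_pathThrough,
      count_flat_eq_length_flatHeights 0, flatHeights_pathThrough, inStrip_pathThrough,
      boundaryPairs, mem_filter, mem_product, Finset.mem_range, mem_boundedLists, true_and,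
      zero_add]
    constructor
    · rintro ⟨h1, h2, -, h3, h4⟩
      exact ⟨⟨by omega, h2, h4⟩, by omega⟩
    · rintro ⟨⟨h1, h2, h3⟩, h4⟩
      exact ⟨by omega, h2, by omega, by omega, h3⟩
  refine ⟨Set.BijOn.equiv f (s := boundaryPairs k r m) ⟨fun p hp => (hmem p).2 hp, ?_, ?_⟩⟩
  · intro p _ p' _ h
    have h1 := congrArg (flatHeights 0) h
    have h2 := congrArg rise h
    simp only [f, flatHeights_pathThrough] at h1 h2
    have h3 := rise_pathThrough 0 p.2 p.1
    have h4 := rise_pathThrough 0 p'.2 p'.1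
    exact Prod.ext (by omega) h1
  · intro u hu
    have h1 := pathThrough_flatHeights hu.1 0
    have h2 := hu.2.2.2 u.length le_rfl
    rw [height_length] at h2
    have hf : f ((rise u).toNat, flatHeights 0 u) = u := by
      simp only [f]
      rwa [show ((rise u).toNat : ℤ) = 0 + rise u by omega]
    exact ⟨_, (hmem _).1 (by rwa [hf]), hf⟩

/-- Appending a flat step creates no corner and no new height. -/
theorem nonempty_steps_equiv_prefixes (m r k : ℕ) :
    Nonempty (cornerlessSteps m r k ≃ cornerlessPrefixes m (r + 1) k) := by
  let f : List Step → LatticePath := fun u => ⟨0, u ++ [.flat]⟩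
  have hmem : ∀ u, f u ∈ cornerlessPrefixes m (r + 1) k ↔ u ∈ cornerlessSteps m r k := by
    intro u
    have h1 : LatticePath.InStrip ⟨0, u ++ [.flat]⟩ 0 k ↔ LatticePath.InStrip ⟨0, u⟩ 0 k := by
      rw [inStrip_append, and_iff_left_iff_imp]
      intro h
      have := h u.length le_rfl
      rw [height_length] at this
      simp only [inStrip_cons, inStrip_nil, Step.rise, add_zero, and_self]
      exact this
    have h2 : (u ++ [Step.flat]).IsChain Step.Smooth ↔ u.IsChain Step.Smooth := by
      simp [List.isChain_append, Step.Smooth]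
    rw [mem_cornerlessPrefixes]
    simp only [f, LatticePath.length, LatticePath.flats, cornerless_iff_isChain, h1, h2,
      cornerlessSteps, Set.mem_ofPred_eq, List.length_append, List.count_append, List.length_singleton,
      List.getLast?_append, true_and, ← add_assoc, add_left_inj, List.count_singleton_self]
    simp
    tauto
  refine ⟨Set.BijOn.equiv f ⟨fun u hu => (hmem u).2 hu, ?_, ?_⟩⟩
  · intro u _ u' _ h
    simpa [f] using h
  · rintro ⟨s, w⟩ hP
    obtain ⟨h1, -, -, -, -, h2⟩ := (mem_cornerlessPrefixes _ _ _ _).1 hP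
    have hf : f w.dropLast = ⟨s, w⟩ := by
      simp only [f, LatticePath.mk.injEq]
      exact ⟨h1.symm, List.dropLast_append_getLast? _ h2⟩
    exact ⟨_, (hmem _).1 (hf ▸ hP), hf⟩

/-- The step sequence of the mirror image. -/
def mirror (w : List Step) : List Step := (w.map Step.flip).reverse

theorem mirror_append (v w : List Step) : mirror (v ++ w) = mirror w ++ mirror v := by
  simp [mirror]

@[simp] theorem length_mirror (w : List Step) : (mirror w).length = w.length := by simp [mirror]

@[simp] theorem mirror_mirror (w : List Step) : mirror (mirror w) = w := by
  have : Step.flip ∘ Step.flip = id := by funext a; cases a <;> rfl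
  simp [mirror, this]

theorem count_flat_mirror (w : List Step) : (mirror w).count .flat = w.count .flat := by
  rw [mirror, List.count_reverse]
  induction w with
  | nil => rfl
  | cons a w ih => cases a <;> simp [Step.flip, ih]

theorem rise_mirror (w : List Step) : rise (mirror w) = -rise w := by
  induction w with
  | nil => rfl
  | cons a w ih =>
    rw [← List.singleton_append, mirror_append, rise_append, ih, rise_append]
    cases a <;> simp [mirror, Step.flip, Step.rise]

theorem isChain_mirror (w : List Step) :
    (mirror w).IsChain Step.Smooth ↔ w.IsChain Step.Smooth := by
  rw [mirror, List.isChain_reverse, List.isChain_map]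
  have : (fun a b => Step.Smooth (Step.flip b) (Step.flip a)) = Step.Smooth := by
    funext a b
    cases a <;> cases b <;> simp [Step.Smooth, Step.flip]
  exact iff_of_eq (congrArg (fun R => List.IsChain R w) this)

theorem inStrip_mirror (s a b : ℤ) (w : List Step) :
    LatticePath.InStrip ⟨s + rise w, mirror w⟩ a b ↔ LatticePath.InStrip ⟨s, w⟩ a b := by
  induction w generalizing s with
  | nil => simp [mirror]
  | cons x w ih =>
    have hx : s + x.rise + x.flip.rise = s := by cases x <;> simp [Step.flip, Step.rise]
    have hm : mirror (x :: w) = mirror w ++ [x.flip] := by simp [mirror]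
    rw [hm, inStrip_append, rise_cons, ← add_assoc, ih, rise_mirror, add_neg_cancel_right,
      inStrip_cons, inStrip_cons, inStrip_nil, hx]
    constructor
    · rintro ⟨h1, -, h2⟩
      exact ⟨h2, h1⟩
    · rintro ⟨h1, h2⟩
      exact ⟨h2, InStrip.start h2, h1⟩

/-- The central `t % 2 + 1` steps must be flat: a single self-mirrored step is flat, and a
self-mirrored pair is a flat pair, a peak or a valley. What precedes them is arbitrary, since flat
steps prevent corners at the junctions. -/
theorem nonempty_steps_equiv_symmetricPaths {t : ℕ} (ht : 2 ≤ t) (m k : ℕ) :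
    Nonempty (cornerlessSteps m (t / 2 - 1) k ≃ cornerlessSymmetricPaths t m k) := by
  let c : List Step := List.replicate (t % 2 + 1) .flat
  let f : List Step → LatticePath := fun u => ⟨0, u ++ (c ++ mirror u)⟩
  have hmirror_c : mirror c = c := by simp [c, mirror, Step.flip]
  have hrise_c : rise c = 0 := by simp [c, rise, Step.rise]
  have hstrip_c : ∀ s a b : ℤ, LatticePath.InStrip ⟨s, c⟩ a b ↔ a ≤ s ∧ s ≤ b := by
    intro s a b
    rcases Nat.mod_two_eq_zero_or_one t with h | h <;>
      simp [c, h, List.replicate_succ, inStrip_cons, inStrip_nil, Step.rise]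
  have hmem : ∀ u, f u ∈ cornerlessSymmetricPaths t m k ↔
      u ∈ cornerlessSteps m (t / 2 - 1) k := by
    intro u
    have h1 : LatticePath.InStrip (f u) 0 k ↔ LatticePath.InStrip ⟨0, u⟩ 0 k := by
      have := inStrip_mirror 0 0 k u
      simp only [f]
      rw [inStrip_append, inStrip_append, hrise_c, add_zero, this, hstrip_c]
      refine ⟨fun h => h.1, fun h => ⟨h, ?_, h⟩⟩
      have := h u.length le_rfl
      rwa [height_length] at this
    have h2 : LatticePath.IsSymmetric (f u) := by
      change mirror (u ++ (c ++ mirror u)) = u ++ (c ++ mirror u)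
      rw [mirror_append, mirror_append, mirror_mirror, hmirror_c, List.append_assoc]
    have h3 : LatticePath.Cornerless (f u) ↔ u.IsChain Step.Smooth := by
      rw [cornerless_iff_isChain, List.isChain_append, List.isChain_append, isChain_mirror]
      have h4 : c.IsChain Step.Smooth := by
        rcases Nat.mod_two_eq_zero_or_one t with h | h <;>
          simp [c, h, List.replicate_succ, Step.Smooth]
      have h5 : c.head? = some .flat := by simp [c, List.replicate_succ]
      have h6 : c.getLast? = some .flat := by simp [c, List.getLast?_replicate]
      refine ⟨fun h => h.1, fun h => ⟨h, ⟨h4, h, ?_⟩, ?_⟩⟩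
      · intro x hx y hy
        rw [h6, Option.mem_some_iff] at hx
        subst hx
        simp [Step.Smooth]
      · intro x hx y hy
        rw [List.head?_append, h5, Option.some_or, Option.mem_some_iff] at hy
        subst hy
        simp [Step.Smooth]
    have h4 : (f u).height (f u).length = 0 := by
      rw [LatticePath.length, height_length, rise_append, rise_append, hrise_c, rise_mirror]
      ring
    have h5 : (f u).length = 2 * u.length + (t % 2 + 1) := by
      simp only [LatticePath.length, f, List.length_append, length_mirror, c,
        List.length_replicate]
      ring
    have h6 : (f u).flats = 2 * u.count .flat + (t % 2 + 1) := by
      simp only [LatticePath.flats, f, List.count_append, count_flat_mirror, c,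
        List.count_replicate_self]
      ring
    rw [h5] at h4
    simp only [cornerlessSymmetricPaths, cornerlessSteps, Set.mem_ofPred_eq, h1, h2, h3, h5, h6,
      LatticePath.IsMotzkin, LatticePath.IsMotzkinPrefix, h4, and_true, true_and]
    constructor
    · rintro ⟨-, h7, h8, h9, h10⟩
      exact ⟨h7, by omega, by omega, h10⟩
    · rintro ⟨h7, h8, h9, h10⟩
      exact ⟨⟨rfl, fun i hi => ((h1.2 h10) i (h5 ▸ hi)).1⟩, h7, by omega, by omega, h10⟩
  refine ⟨Set.BijOn.equiv f ⟨fun u hu => (hmem u).2 hu, ?_, ?_⟩⟩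
  · intro u _ u' _ h
    have h1 := congrArg LatticePath.steps h
    have h2 := congrArg List.length h1
    simp only [f, List.length_append, length_mirror] at h1 h2
    exact (List.append_inj h1 (by omega)).1
  · rintro ⟨s, w⟩ hP
    have hP' := hP
    obtain ⟨⟨⟨h1, -⟩, -⟩, h2, h3, h4, h5, -⟩ := hP'
    change mirror w = w at h2
    simp only [LatticePath.length, LatticePath.flats] at h1 h4 h5
    rw [cornerless_iff_isChain] at h3
    obtain ⟨u, d, v, rfl, hu, hd⟩ : ∃ u d v : List Step, w = u ++ (d ++ v) ∧
        u.length = m + (t / 2 - 1) ∧ d.length = t % 2 + 1 := by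
      refine ⟨w.take (m + (t / 2 - 1)), (w.drop (m + (t / 2 - 1))).take (t % 2 + 1),
        (w.drop (m + (t / 2 - 1))).drop (t % 2 + 1), ?_, ?_, ?_⟩
      · rw [List.take_append_drop, List.take_append_drop]
      · rw [List.length_take]; omega
      · rw [List.length_take, List.length_drop]; omega
    simp only [List.length_append] at h4
    rw [mirror_append, mirror_append, List.append_assoc] at h2
    obtain ⟨h6, h7⟩ := List.append_inj h2 (by rw [length_mirror]; omega)
    obtain ⟨h8, h9⟩ := List.append_inj h7 (by rw [length_mirror])
    have h10 : d.IsChain Step.Smooth :=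
      (List.isChain_append.1 (List.isChain_append.1 h3).2.1).1
    have hdc : d = c := by
      rcases Nat.mod_two_eq_zero_or_one t with h | h
      · rw [h, zero_add, List.length_eq_one_iff] at hd
        obtain ⟨a, rfl⟩ := hd
        cases a <;> simp_all [mirror, Step.flip, c]
      · rw [h, List.length_eq_two] at hd
        obtain ⟨a, b, rfl⟩ := hd
        cases a <;> cases b <;> simp_all [mirror, Step.flip, c, Step.Smooth, List.replicate_succ]
    have hf : f u = ⟨s, u ++ (d ++ v)⟩ := by
      simp only [f, h1, hdc, h9]
    exact ⟨u, (hmem u).1 (hf ▸ hP), hf⟩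

/-- Without flat steps a cornerless path is monotone, so equal endpoints force it to be empty. -/
theorem symmetricPaths_one (m k : ℕ) :
    (cornerlessSymmetricPaths 1 m k).Subsingleton ∧
      ((cornerlessSymmetricPaths 1 m k).Nonempty ↔ m = 0) := by
  have key : ∀ P ∈ cornerlessSymmetricPaths 1 m k, P = ⟨0, []⟩ ∧ m = 0 := by
    rintro ⟨s, w⟩ ⟨⟨⟨h1, -⟩, h2⟩, -, h3, h4, h5, -⟩
    simp only [LatticePath.length, LatticePath.flats] at h1 h2 h4 h5
    subst h1
    rw [cornerless_iff_isChain] at h3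
    rw [height_length] at h2
    rw [count_flat_eq_length_flatHeights 0, Nat.add_eq_right, List.length_eq_zero_iff] at h5
    have := pathThrough_flatHeights h3 0
    rw [h2, h5, pathThrough, verticalSteps_self] at this
    subst this
    simp only [List.length_nil] at h4
    exact ⟨rfl, by omega⟩
  refine ⟨fun P hP Q hQ => (key P hP).1.trans (key Q hQ).1.symm,
    fun ⟨P, hP⟩ => (key P hP).2, fun h => ⟨⟨0, []⟩, ?_⟩⟩
  simp [cornerlessSymmetricPaths, LatticePath.IsMotzkin, LatticePath.IsMotzkinPrefix,
    LatticePath.IsSymmetric, LatticePath.flats, LatticePath.length, LatticePath.height,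
    LatticePath.InStrip, cornerless_iff_isChain, h]

/-- The only link obtained from equal cardinalities rather than from an explicit map. -/
theorem nonempty_sequences_equiv_steps {t : ℕ} (ht : 2 ≤ t) (m k : ℕ) :
    Nonempty (boundedSequences t m k ≃ cornerlessSteps m (t / 2 - 1) k) := by
  obtain ⟨e₁⟩ := nonempty_middlePairs_equiv_sequences (t := t) (r := t / 2 - 1) (by omega) m k
  obtain ⟨e₂⟩ := nonempty_boundaryPairs_equiv_steps m (t / 2 - 1) k
  exact ⟨(e₁.symm.trans (Finset.equivOfCardEq (card_middlePairs k _ m))).trans e₂⟩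

end CoreMotzkin

theorem mainTheorem7 (t m k : ℕ) :
    Nonempty (CoreMotzkin.selfConjugateCores t m k ≃ CoreMotzkin.boundedSequences t m k) ∧
    Nonempty (CoreMotzkin.selfConjugateCores t m k ≃
      CoreMotzkin.cornerlessFreePaths m (t / 2) k) ∧
    (1 ≤ t → Nonempty (CoreMotzkin.selfConjugateCores t m k ≃
      CoreMotzkin.cornerlessSymmetricPaths t m k)) ∧
    (2 ≤ t → Nonempty (CoreMotzkin.selfConjugateCores t m k ≃
      CoreMotzkin.cornerlessPrefixes m (t / 2) k)) := by
  obtain ⟨e⟩ : Nonempty (CoreMotzkin.selfConjugateCores t m k ≃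
      CoreMotzkin.boundedSequences t m k) := by
    rcases Nat.eq_zero_or_pos t with rfl | ht
    · exact CoreMotzkin.nonempty_cores_zero_equiv m k
    · exact CoreMotzkin.nonempty_cores_equiv_sequences ht m k
  obtain ⟨e₁⟩ := CoreMotzkin.nonempty_sequences_equiv_freePaths t m k
  refine ⟨⟨e⟩, ⟨e.trans e₁⟩, fun ht => ?_, fun ht => ?_⟩
  · rcases ht.eq_or_lt with rfl | ht
    · obtain ⟨h1, h2⟩ := CoreMotzkin.boundedSequences_of_lt_two (t := 1) (by omega) m k
      obtain ⟨h3, h4⟩ := CoreMotzkin.symmetricPaths_one m k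
      obtain ⟨e₂⟩ := CoreMotzkin.nonempty_equiv_of_subsingleton h1 h3 (h2.trans h4.symm)
      exact ⟨e.trans e₂⟩
    · obtain ⟨e₂⟩ := CoreMotzkin.nonempty_sequences_equiv_steps ht m k
      obtain ⟨e₃⟩ := CoreMotzkin.nonempty_steps_equiv_symmetricPaths ht m k
      exact ⟨e.trans (e₂.trans e₃)⟩
  · obtain ⟨e₂⟩ := CoreMotzkin.nonempty_sequences_equiv_steps ht m k
    obtain ⟨e₃⟩ := CoreMotzkin.nonempty_steps_equiv_prefixes m (t / 2 - 1) k
    rw [Nat.sub_add_cancel (show 1 ≤ t / 2 by omega)] at e₃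
    exact ⟨e.trans (e₂.trans e₃)⟩
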